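/- Let $\mathcal C$ be a unitary fusion category, that is, a $\mathbb C$-linear semisimple abelian rigid monoidal category with finite-dimensional morphism spaces, finitely many isomorphism classes of simple objects, simple unit object and bilinear tensor product, equipped with an antilinear, involutive, contravariant, identity-on-objects dagger $f\mapsto f^\dagger$ such that every $f^\dagger f$ is positive (of the form $g^\dagger g$ with $g$ an endomorphism), $f^\dagger f=0$ only if $f=0$, $(f\otimes g)^\dagger=f^\dagger\otimes g^\dagger$, and the associators and unitors are unitary. Let $x_0,\dots,x_r$ be representatives of the isomorphism classes of simple objects, let $N_j$ be the fusion matrix of $x_j$, with entries $(N_j)_{l,k}=\dim\operatorname{Hom}(x_j\otimes x_k,x_l)$, and let $d_j>0$ be the quantum dimension of $x_j$, i.e. the common value $\mathrm{coev}^\dagger\,\mathrm{coev}=\mathrm{ev}\,\mathrm{ev}^\dagger=d_j\,\mathrm{id}_{\mathbf 1}$ of the two loops of a duality pairing $\mathrm{coev}:\mathbf 1\to x_j\otimes \overline{x_j}$, $\mathrm{ev}:\overline{x_j}\otimes x_j\to\mathbf 1$ normalized so that the two loops agree. Then for every $n\in\mathbb N$ (including $n=0$) $$\sum_{j=0}^r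 d_j^{-n+2}\,N_j^{\otimes n}\ \ge 0,$$ i.e. this matrix, where $N_j^{\otimes n}$ is the $n$-fold Kronecker power, is positive semidefinite. Moreover, let $\mathcal M$ be a unitary (left) module category over $\mathcal C$, that is, a $\mathbb C$-linear semisimple abelian category with finite-dimensional morphism spaces and finitely many isomorphism classes of simple objects, represented by $m_0,\dots,m_s$, with a dagger that is positive in the same sense, and with a bilinear action $\mathcal C\times\mathcal M\to\mathcal M$ compatible with the daggers and with unitary associativity and unit constraints. Then for every $n\in\mathbb N$ the same inequality $\sum_{j=0}^r d_j^{-n+2}N_j^{\otimes n}\ge 0$ holds with $N_j$ replaced by the matrix of $x_j$ acting on $K_0(\mathcal M)$, with entries $(N_j)_{l,k}=\dim\operatorname{Hom}(x_j\cdot m_k,m_l)$. -/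

import Mathlib

open CategoryTheory MonoidalCategory Limits
open scoped ComplexConjugate ComplexOrder

universe v u v' u'

/-- A dagger structure: an involutive contravariant functor that is the identity on objects. -/
class DaggerCategory (C : Type u) [Category.{v} C] where
  /-- The adjoint `f† : Y ⟶ X` of `f : X ⟶ Y`. -/
  dag {X Y : C} (f : X ⟶ Y) : Y ⟶ X
  dag_id (X : C) : dag (𝟙 X) = 𝟙 X
  dag_comp {X Y Z : C} (f : X ⟶ Y) (g : Y ⟶ Z) : dag (f ≫ g) = dag g ≫ dag f
  dag_dag {X Y : C} (f : X ⟶ Y) : dag (dag f) = f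

open DaggerCategory (dag)

/-- A unitary category: a semisimple `ℂ`-linear abelian category with finite-dimensional hom
spaces and an antilinear dagger that makes it a C*-category. Since all hom spaces are
finite-dimensional, the C*-condition amounts to: every `f† ∘ f` (written `f ≫ dag f`) is a
positive element `g† ∘ g` of the endomorphism algebra, and it vanishes only if `f = 0`. -/
class UnitaryCategory (C : Type u) [Category.{v} C] [Abelian C] [Linear ℂ C] extends
    DaggerCategory C where
  finiteDimensional_hom (X Y : C) : FiniteDimensional ℂ (X ⟶ Y)
  semisimple (X : C) : ∃ (k : ℕ) (S : Fin k → C) (b : Bicone S),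
    (∀ i, Simple (S i)) ∧ Nonempty b.IsBilimit ∧ Nonempty (b.pt ≅ X)
  dag_add {X Y : C} (f g : X ⟶ Y) : dag (f + g) = dag f + dag g
  dag_smul {X Y : C} (c : ℂ) (f : X ⟶ Y) : dag (c • f) = conj c • dag f
  dag_positive {X Y : C} (f : X ⟶ Y) : ∃ g : X ⟶ X, f ≫ dag f = g ≫ dag g
  dag_definite {X Y : C} (f : X ⟶ Y) : f ≫ dag f = 0 → f = 0

/-- `x` lists the simple objects of `C`, exactly one from each isomorphism class. -/
structure IsSimpleList {C : Type u} [Category.{v} C] [Abelian C] {ι : Type*} (x : ι → C) :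
    Prop where
  simple (i : ι) : Simple (x i)
  irredundant (i j : ι) : Nonempty (x i ≅ x j) → i = j
  complete (S : C) : Simple S → ∃ i, Nonempty (S ≅ x i)

/-- A unitary fusion category: a unitary category that is rigid monoidal with bilinear tensor
product, simple unit and finitely many simple objects up to isomorphism, whose tensor product
is compatible with the dagger and whose associators and unitors are unitary. -/
class UnitaryFusionCategory (C : Type u) [Category.{v} C] [Abelian C] [Linear ℂ C]
    [MonoidalCategory C] [MonoidalPreadditive C] [MonoidalLinear ℂ C] [RigidCategory C]
    [UnitaryCategory C] : Prop where
  simple_unit : Simple (𝟙_ C)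
  finite_simples : ∃ (k : ℕ) (x : Fin k → C), IsSimpleList x
  dag_tensorHom {X Y X' Y' : C} (f : X ⟶ Y) (g : X' ⟶ Y') :
    dag (f ⊗ₘ g) = dag f ⊗ₘ dag g
  dag_associator (X Y Z : C) : dag (α_ X Y Z).hom = (α_ X Y Z).inv
  dag_leftUnitor (X : C) : dag (λ_ X).hom = (λ_ X).inv
  dag_rightUnitor (X : C) : dag (ρ_ X).hom = (ρ_ X).inv

open scoped MonoidalLeftAction in
/-- A unitary (left) module category over `C`: a unitary category `M` with a bilinear action
`C × M → M` that is compatible with the daggers and has unitary associativity and unit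
constraints. -/
class UnitaryModuleCategory (C : Type u) [Category.{v} C] [Abelian C] [Linear ℂ C]
    [MonoidalCategory C] [DaggerCategory C] (M : Type u') [Category.{v'} M] [Abelian M]
    [Linear ℂ M] [UnitaryCategory M] [MonoidalLeftAction C M] : Prop where
  add_actionHomLeft {X Y : C} (f g : X ⟶ Y) (m : M) : (f + g) ⊵ₗ m = f ⊵ₗ m + g ⊵ₗ m
  smul_actionHomLeft {X Y : C} (c : ℂ) (f : X ⟶ Y) (m : M) : (c • f) ⊵ₗ m = c • (f ⊵ₗ m)
  actionHomRight_add (X : C) {m m' : M} (f g : m ⟶ m') : X ⊴ₗ (f + g) = X ⊴ₗ f + X ⊴ₗ g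
  actionHomRight_smul (X : C) {m m' : M} (c : ℂ) (f : m ⟶ m') :
    X ⊴ₗ (c • f) = c • (X ⊴ₗ f)
  dag_actionHomLeft {X Y : C} (f : X ⟶ Y) (m : M) : dag (f ⊵ₗ m) = dag f ⊵ₗ m
  dag_actionHomRight (X : C) {m m' : M} (f : m ⟶ m') : dag (X ⊴ₗ f) = X ⊴ₗ dag f
  dag_actionAssocIso (X Y : C) (m : M) : dag (αₗ X Y m).hom = (αₗ X Y m).inv
  dag_actionUnitIso (m : M) : dag (λₗ[C] m).hom = (λₗ[C] m).inv

/-- The quantum dimension of `X`: the least value `d` of the two closed loops `coev† ∘ coev` and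
`ev ∘ ev†`, over all duality pairings of `X` normalized so that the two loops agree. In a unitary
fusion category this is the categorical dimension for the canonical (unitary) spherical structure;
for simple `X` all normalized pairings give the same `d`. -/
noncomputable def quantumDim {C : Type u} [Category.{v} C] [Abelian C] [Linear ℂ C]
    [MonoidalCategory C] [DaggerCategory C] (X : C) : ℝ :=
  sInf {d : ℝ | ∃ (Y : C) (_ : ExactPairing X Y),
    η_ X Y ≫ dag (η_ X Y) = (d : ℂ) • 𝟙 (𝟙_ C) ∧
    dag (ε_ X Y) ≫ ε_ X Y = (d : ℂ) • 𝟙 (𝟙_ C)}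

/-- The fusion matrix of `X` on the basis `x` of `K₀(C)`: the column of `x k` holds the
multiplicities of the simple objects `x l` in `X ⊗ x k`. -/
noncomputable def fusionMatrix {C : Type u} [Category.{v} C] [Abelian C] [Linear ℂ C]
    [MonoidalCategory C] {ι : Type*} (x : ι → C) (X : C) : Matrix ι ι ℂ :=
  Matrix.of fun l k => (Module.finrank ℂ (X ⊗ x k ⟶ x l) : ℂ)

open scoped MonoidalLeftAction in
/-- The fusion matrix of `X : C` on the basis `m` of `K₀(M)`: the column of `m k` holds the
multiplicities of the simple objects `m l` in `X ⊙ₗ m k`. -/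
noncomputable def moduleFusionMatrix {C : Type u} [Category.{v} C] [MonoidalCategory C]
    {M : Type u'} [Category.{v'} M] [Abelian M] [Linear ℂ M] [MonoidalLeftAction C M]
    {κ : Type*} (m : κ → M) (X : C) : Matrix κ κ ℂ :=
  Matrix.of fun l k => (Module.finrank ℂ (X ⊙ₗ m k ⟶ m l) : ℂ)

/-- The `n`-fold Kronecker power `A ⊗ ⋯ ⊗ A`, indexed by `n`-tuples. -/
def kroneckerPow {ι : Type*} (A : Matrix ι ι ℂ) (n : ℕ) : Matrix (Fin n → ι) (Fin n → ι) ℂ :=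
  Matrix.of fun a b => ∏ i, A (a i) (b i)

/-!
A natural family `ξ_A : Z ⊗ A ⟶ A` and a second one `ξ'` can be glued along `Z` over `A = B ⊗ x j`.
Closing the strand `x j` and averaging over `B` gives a sesquilinear form `⟨ξ, ξ'⟩_j`. By the
handle slide, `∑ j, d_j ⟨ξ, ξ'⟩_j = ⟨ω ξ, ω ξ'⟩`, where `ω ξ : Z ⟶ 𝟙` closes `ξ` by the loop
`∑ t, d_t x_t`; so this sum is positive on the diagonal.

Tracing `x a` out of the action of `x k ⊗ (x k)*` on the `x k`-isotypic part of `A ⊗ x a` gives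
families `T_{k,a}` such that composing with them multiplies the forms by the fusion matrix:
`∑ k, d_k⁻¹ ⟨ξ T_{k,a}, ξ' T_{k,b}⟩_j = d_j⁻¹ (N_j)_{a,b} ⟨ξ, ξ'⟩_j`. After `n` compositions, the
form becomes `∑ j, d_j ^ (2 - n) N_j^{⊗n}` up to the global dimension.

For a module category, `A_i A_j = ∑ p, N_{ij}^p A_p`. Hence an eigenvector `v` of
`∑ j, d_j ^ (2 - n) A_j^{⊗n}` yields the left eigenvector `P ↦ ⟨v, (A_{P 1} ⊗ ⋯ ⊗ A_{P n}) v⟩` of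
`∑ j, d_j ^ (2 - n) N_j^{⊗n}` with the same eigenvalue.
-/

open DaggerCategory UnitaryCategory

attribute [simp] dag_id dag_comp dag_dag dag_add dag_smul

attribute [instance] finiteDimensional_hom UnitaryFusionCategory.simple_unit

lemma hom_eq_zero_of_not_iso {D : Type u} [Category.{v} D] [Preadditive D] [HasKernels D]
    {k l : D} [Simple k] [Simple l] (h : ¬ Nonempty (k ≅ l)) (f : k ⟶ l) : f = 0 := by
  by_contra hf
  have := isIso_of_hom_simple hf
  exact h ⟨asIso f⟩

section SchurScalar

variable {D : Type u} [Category.{v} D] [Preadditive D] [HasKernels D] [Linear ℂ D]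

/-- Schur's lemma: the endomorphisms of a simple object are its scalars. -/
noncomputable def schurEquiv (k : D) [Simple k] [FiniteDimensional ℂ (k ⟶ k)] :
    ℂ ≃ₗ[ℂ] (k ⟶ k) :=
  LinearEquiv.ofBijective (LinearMap.toSpanSingleton ℂ (k ⟶ k) (𝟙 k))
    ⟨smul_left_injective ℂ (id_nonzero k), endomorphism_simple_eq_smul_id ℂ⟩

/-- The scalar by which an endomorphism of a simple object acts. -/
noncomputable def schurScalar (k : D) [Simple k] [FiniteDimensional ℂ (k ⟶ k)] :
    (k ⟶ k) →ₗ[ℂ] ℂ :=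
  (schurEquiv k).symm

variable {k l : D} [Simple k] [FiniteDimensional ℂ (k ⟶ k)] [Simple l]
  [FiniteDimensional ℂ (l ⟶ l)]

lemma schurScalar_smul_id (f : k ⟶ k) : schurScalar k f • 𝟙 k = f :=
  (schurEquiv k).apply_symm_apply f

lemma schurScalar_eq {f : k ⟶ k} {c : ℂ} (h : f = c • 𝟙 k) : schurScalar k f = c :=
  smul_left_injective ℂ (id_nonzero k) ((schurScalar_smul_id f).trans h)

@[simp] lemma schurScalar_id (k : D) [Simple k] [FiniteDimensional ℂ (k ⟶ k)] :
    schurScalar k (𝟙 k) = 1 :=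
  schurScalar_eq (one_smul _ _).symm

lemma schurScalar_comp (f g : k ⟶ k) :
    schurScalar k (f ≫ g) = schurScalar k f * schurScalar k g := by
  conv_lhs => rw [← schurScalar_smul_id f]
  simp

end SchurScalar

namespace UnitaryCategory

variable {D : Type u} [Category.{v} D] [Abelian D] [Linear ℂ D] [UnitaryCategory D]

@[simp] lemma dag_zero (X Y : D) : dag (0 : X ⟶ Y) = 0 :=
  map_zero (AddMonoidHom.mk' dag dag_add)

@[simp] lemma dag_sum {X Y : D} {I : Type*} (s : Finset I) (f : I → (X ⟶ Y)) :
    dag (∑ i ∈ s, f i) = ∑ i ∈ s, dag (f i) :=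
  map_sum (AddMonoidHom.mk' dag dag_add) f s

lemma schurScalar_dag {k : D} [Simple k] (f : k ⟶ k) :
    schurScalar k (dag f) = conj (schurScalar k f) := by
  apply schurScalar_eq
  conv_lhs => rw [← schurScalar_smul_id f, dag_smul, dag_id]

lemma schurScalar_comp_dag_nonneg {k X : D} [Simple k] (f : k ⟶ X) :
    0 ≤ schurScalar k (f ≫ dag f) := by
  obtain ⟨g, hg⟩ := dag_positive f
  rw [hg, schurScalar_comp, schurScalar_dag, Complex.mul_conj]
  exact_mod_cast Complex.normSq_nonneg _

lemma schurScalar_dag_comp_nonneg {k X : D} [Simple k] (f : X ⟶ k) :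
    0 ≤ schurScalar k (dag f ≫ f) := by
  simpa using schurScalar_comp_dag_nonneg (dag f)

lemma exists_pos_comp_dag_eq_smul_id {k X : D} [Simple k] {f : k ⟶ X} (hf : f ≠ 0) :
    ∃ p : ℝ, 0 < p ∧ f ≫ dag f = (p : ℂ) • 𝟙 k := by
  have hs : schurScalar k (f ≫ dag f) ≠ 0 := fun h =>
    hf (dag_definite f (by rw [← schurScalar_smul_id (f ≫ dag f), h, zero_smul]))
  obtain ⟨p, hp, hpf⟩ := RCLike.pos_iff_exists_ofReal.1
    ((schurScalar_comp_dag_nonneg f).lt_of_ne' hs)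
  exact ⟨p, hp, by rw [← schurScalar_smul_id (f ≫ dag f), ← hpf]; rfl⟩

lemma exists_pos_dag_comp_eq_smul_id {k X : D} [Simple k] {f : X ⟶ k} (hf : f ≠ 0) :
    ∃ p : ℝ, 0 < p ∧ dag f ≫ f = (p : ℂ) • 𝟙 k := by
  have hf' : dag f ≠ 0 := fun h => hf (by rw [← dag_dag f, h, dag_zero])
  simpa using exists_pos_comp_dag_eq_smul_id hf'

/-- The inner product `⟪f, g⟫ = g ∘ f†` on the morphisms into a simple object. -/
@[reducible]
noncomputable def homInnerCore (X k : D) [Simple k] : InnerProductSpace.Core ℂ (X ⟶ k) where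
  inner f g := schurScalar k (dag f ≫ g)
  conj_inner_symm f g := by rw [← schurScalar_dag, dag_comp, dag_dag]
  re_inner_nonneg f := (Complex.le_def.1 (schurScalar_dag_comp_nonneg f)).1
  add_left f g h := by simp
  smul_left f g c := by simp
  definite f h := by
    by_contra hf
    obtain ⟨p, hp, hpf⟩ := exists_pos_dag_comp_eq_smul_id hf
    exact hp.ne' (by exact_mod_cast (schurScalar_eq hpf).symm.trans h)

lemma exists_orthonormal_hom_basis (X k : D) [Simple k] :
    ∃ u : Fin (Module.finrank ℂ (X ⟶ k)) → (X ⟶ k),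
      (∀ i j, dag (u i) ≫ u j = if i = j then 𝟙 k else 0) ∧
      ∀ f : X ⟶ k, ∑ i, u i ≫ dag (u i) ≫ f = f := by
  let c := homInnerCore X k
  let : NormedAddCommGroup (X ⟶ k) := c.toNormedAddCommGroup
  let : InnerProductSpace ℂ (X ⟶ k) := InnerProductSpace.ofCore c.toCore
  have inner_smul_id (f g : X ⟶ k) : inner ℂ f g • 𝟙 k = dag f ≫ g := schurScalar_smul_id _
  let b := stdOrthonormalBasis ℂ (X ⟶ k)
  refine ⟨b, fun i j => ?_, fun f => ?_⟩
  · rw [← inner_smul_id, orthonormal_iff_ite.1 b.orthonormal i j, ite_smul, one_smul, zero_smul]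
  · simpa only [← inner_smul_id, Linear.comp_smul, Category.comp_id] using b.sum_repr' f

/-- A chosen orthonormal basis of the space of morphisms from `X` to a simple object. -/
noncomputable def onb (X k : D) [Simple k] : Fin (Module.finrank ℂ (X ⟶ k)) → (X ⟶ k) :=
  (exists_orthonormal_hom_basis X k).choose

lemma dag_onb_comp_onb (X k : D) [Simple k] (i j) :
    dag (onb X k i) ≫ onb X k j = if i = j then 𝟙 k else 0 :=
  (exists_orthonormal_hom_basis X k).choose_spec.1 i j

lemma sum_onb_comp {X k : D} [Simple k] (f : X ⟶ k) :
    ∑ i, onb X k i ≫ dag (onb X k i) ≫ f = f :=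
  (exists_orthonormal_hom_basis X k).choose_spec.2 f

lemma sum_comp_onb {X k : D} [Simple k] (f : k ⟶ X) :
    ∑ i, (f ≫ onb X k i) ≫ dag (onb X k i) = f := by
  simpa using congrArg dag (sum_onb_comp (dag f))

/-- The orthogonal projection onto the part of `X` that is a multiple of the simple object `k`. -/
noncomputable def isotypicProj (X k : D) [Simple k] : X ⟶ X :=
  ∑ i, onb X k i ≫ dag (onb X k i)

lemma isotypicProj_eq_sum (X k : D) [Simple k] :
    isotypicProj X k = ∑ i, onb X k i ≫ dag (onb X k i) := rfl

lemma isotypicProj_comp {X k : D} [Simple k] (f : X ⟶ k) : isotypicProj X k ≫ f = f := by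
  simpa [isotypicProj, Preadditive.sum_comp] using sum_onb_comp f

lemma comp_isotypicProj {X k : D} [Simple k] (f : k ⟶ X) : f ≫ isotypicProj X k = f := by
  simpa [isotypicProj, Preadditive.comp_sum] using sum_comp_onb f

lemma hom_ext_simple {X Y : D} {f g : Y ⟶ X}
    (h : ∀ (S : D) [Simple S] (p : X ⟶ S), f ≫ p = g ≫ p) : f = g := by
  obtain ⟨n, S, b, hS, ⟨hb⟩, ⟨e⟩⟩ := semisimple X
  rw [← cancel_mono e.inv]
  refine hb.isLimit.hom_ext fun ⟨i⟩ => ?_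
  have := hS i
  simpa using h (S i) (e.inv ≫ b.π i)

lemma simple_of_forall_eq_smul_id {X : D} (hX : 𝟙 X ≠ 0)
    (h : ∀ f : X ⟶ X, ∃ c : ℂ, f = c • 𝟙 X) : Simple X := by
  obtain ⟨S, _, p, hp⟩ : ∃ (S : D) (_ : Simple S) (p : X ⟶ S), p ≠ 0 := by
    by_contra! hc
    exact hX (hom_ext_simple fun S hS p => by rw [hc S hS p, comp_zero, comp_zero])
  obtain ⟨c, hc⟩ := h (p ≫ dag p)
  have hc0 : c ≠ 0 := fun h0 => hp (dag_definite p (by rw [hc, h0, zero_smul]))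
  have : IsSplitMono p := ⟨⟨⟨c⁻¹ • dag p, by simp [hc, smul_smul, hc0]⟩⟩⟩
  have : IsIso p := isIso_of_mono_of_nonzero hp
  exact Simple.of_iso (asIso p)

end UnitaryCategory

namespace IsSimpleList

variable {D : Type u} [Category.{v} D] [Abelian D]

lemma eq_id_of_forall_comp [Linear ℂ D] [UnitaryCategory D] {ι : Type*} {x : ι → D}
    (hx : IsSimpleList x) {X : D} {e : X ⟶ X} (h : ∀ p (f : X ⟶ x p), e ≫ f = f) : e = 𝟙 X := by
  refine hom_ext_simple fun S _ f => ?_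
  obtain ⟨p, ⟨i⟩⟩ := hx.complete S ‹_›
  rw [← cancel_mono i.hom, Category.id_comp, Category.assoc]
  exact h p _

variable {ι : Type*} {x : ι → D} (hx : IsSimpleList x) [∀ i, Simple (x i)]
include hx

lemma hom_eq_zero {p q : ι} (h : p ≠ q) (f : x p ⟶ x q) : f = 0 :=
  hom_eq_zero_of_not_iso (fun e => h (hx.irredundant p q e)) f

variable [Linear ℂ D] [UnitaryCategory D] [Fintype ι]

lemma sum_comp_dag_eq_id {X : D} {n : ι → ℕ} {σ : ι → ι} (hσ : Function.Bijective σ)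
    (v : (p : ι) → Fin (n p) → (X ⟶ x (σ p))) (c : ι → ℂ)
    (h : ∀ p (f : X ⟶ x (σ p)), c p • ∑ i, v p i ≫ dag (v p i) ≫ f = f) :
    ∑ p, c p • ∑ i, v p i ≫ dag (v p i) = 𝟙 X := by
  refine hx.eq_id_of_forall_comp fun p f => ?_
  obtain ⟨p, rfl⟩ := hσ.surjective p
  rw [Preadditive.sum_comp, Fintype.sum_eq_single p]
  · simpa only [Linear.smul_comp, Preadditive.sum_comp, Category.assoc] using h p f
  · intro q hq
    simp [Preadditive.sum_comp, hx.hom_eq_zero (hσ.injective.ne hq) (dag (v q _) ≫ f)]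

lemma sum_onb_comp_dag_onb (X : D) :
    ∑ p, ∑ i, onb X (x p) i ≫ dag (onb X (x p) i) = 𝟙 X := by
  simpa using hx.sum_comp_dag_eq_id Function.bijective_id (fun p => onb X (x p)) (fun _ => 1)
    (fun p f => by simpa using sum_onb_comp f)

end IsSimpleList

/-- A dagger monoidal category: the tensor product is compatible with the dagger, and the
associators and unitors are unitary. -/
class DaggerMonoidalCategory (C : Type u) [Category.{v} C] [MonoidalCategory C]
    [DaggerCategory C] : Prop where
  dag_tensorHom {X Y X' Y' : C} (f : X ⟶ Y) (g : X' ⟶ Y') : dag (f ⊗ₘ g) = dag f ⊗ₘ dag g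
  dag_associator (X Y Z : C) : dag (α_ X Y Z).hom = (α_ X Y Z).inv
  dag_leftUnitor (X : C) : dag (λ_ X).hom = (λ_ X).inv
  dag_rightUnitor (X : C) : dag (ρ_ X).hom = (ρ_ X).inv

namespace DaggerMonoidalCategory

instance {C : Type u} [Category.{v} C] [Abelian C] [Linear ℂ C] [MonoidalCategory C]
    [MonoidalPreadditive C] [MonoidalLinear ℂ C] [RigidCategory C] [UnitaryCategory C]
    [UnitaryFusionCategory C] : DaggerMonoidalCategory C where
  dag_tensorHom := UnitaryFusionCategory.dag_tensorHom
  dag_associator := UnitaryFusionCategory.dag_associator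
  dag_leftUnitor := UnitaryFusionCategory.dag_leftUnitor
  dag_rightUnitor := UnitaryFusionCategory.dag_rightUnitor

attribute [simp] dag_associator dag_leftUnitor dag_rightUnitor

variable {C : Type u} [Category.{v} C] [MonoidalCategory C] [DaggerCategory C]
  [DaggerMonoidalCategory C]

@[simp] lemma dag_whiskerLeft (X : C) {Y Z : C} (f : Y ⟶ Z) : dag (X ◁ f) = X ◁ dag f := by
  rw [← id_tensorHom, dag_tensorHom, dag_id, id_tensorHom]

@[simp] lemma dag_whiskerRight {Y Z : C} (f : Y ⟶ Z) (X : C) : dag (f ▷ X) = dag f ▷ X := by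
  rw [← tensorHom_id, dag_tensorHom, dag_id, tensorHom_id]

@[simp] lemma dag_associator_inv (X Y Z : C) : dag (α_ X Y Z).inv = (α_ X Y Z).hom := by
  rw [← dag_associator, dag_dag]

@[simp] lemma dag_leftUnitor_inv (X : C) : dag (λ_ X).inv = (λ_ X).hom := by
  rw [← dag_leftUnitor, dag_dag]

@[simp] lemma dag_rightUnitor_inv (X : C) : dag (ρ_ X).inv = (ρ_ X).hom := by
  rw [← dag_rightUnitor, dag_dag]

end DaggerMonoidalCategory

section ExactPairings

variable {C : Type u} [Category.{v} C] [Abelian C] [MonoidalCategory C] [MonoidalPreadditive C]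
  (X Y : C) [Simple X] [ExactPairing X Y]

lemma coevaluation_ne_zero : η_ X Y ≠ 0 := fun h =>
  id_nonzero X <| by
    simpa [h] using ((λ_ X).inv ≫= ExactPairing.evaluation_coevaluation X Y =≫ (ρ_ X).hom).symm

lemma evaluation_ne_zero : ε_ X Y ≠ 0 := fun h =>
  id_nonzero X <| by
    simpa [h] using ((λ_ X).inv ≫= ExactPairing.evaluation_coevaluation X Y =≫ (ρ_ X).hom).symm

variable [Linear ℂ C] [MonoidalLinear ℂ C] [UnitaryCategory C]

include X in
lemma end_dual_eq_smul_id (f : Y ⟶ Y) : ∃ c : ℂ, f = c • 𝟙 Y := by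
  let : HasLeftDual Y := ⟨X⟩
  obtain ⟨c, hc⟩ := endomorphism_simple_eq_smul_id ℂ (ᘁf)
  refine ⟨c, ?_⟩
  have hf : η_ X Y ≫ X ◁ f = η_ X Y ≫ X ◁ (c • 𝟙 Y) :=
    calc η_ X Y ≫ X ◁ f = η_ X Y ≫ (ᘁf) ▷ Y := (coevaluation_comp_leftAdjointMate f).symm
      _ = η_ X Y ≫ (c • 𝟙 X) ▷ Y := congrArg (fun t : X ⟶ X => η_ X Y ≫ t ▷ Y) hc.symm
      _ = η_ X Y ≫ X ◁ (c • 𝟙 Y) := by simp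
  have transpose := congrArg (tensorLeftHomEquiv (𝟙_ C) X Y Y).symm hf
  rw [tensorLeftHomEquiv_symm_coevaluation_comp_whiskerLeft,
    tensorLeftHomEquiv_symm_coevaluation_comp_whiskerLeft] at transpose
  exact (cancel_epi _).1 transpose

lemma simple_right_of_exactPairing (X Y : C) [Simple X] [ExactPairing X Y] : Simple Y := by
  refine simple_of_forall_eq_smul_id (fun h => coevaluation_ne_zero X Y ?_)
    (end_dual_eq_smul_id X Y)
  rw [← Category.comp_id (η_ X Y), ← MonoidalCategory.whiskerLeft_id, h,
    MonoidalPreadditive.whiskerLeft_zero, comp_zero]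

end ExactPairings

/-- A duality pairing between `X` and `Y` both of whose loops have the value `d`. -/
structure BalancedPairing {C : Type u} [Category.{v} C] [Preadditive C] [Linear ℂ C]
    [MonoidalCategory C] [DaggerCategory C] (X Y : C) (d : ℝ) where
  coev : 𝟙_ C ⟶ X ⊗ Y
  ev : Y ⊗ X ⟶ 𝟙_ C
  zag : Y ◁ coev ≫ (α_ Y X Y).inv ≫ ev ▷ Y = (ρ_ Y).hom ≫ (λ_ Y).inv
  zig : coev ▷ X ≫ (α_ X Y X).hom ≫ X ◁ ev = (λ_ X).hom ≫ (ρ_ X).inv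
  coev_loop : coev ≫ dag coev = (d : ℂ) • 𝟙 (𝟙_ C)
  ev_loop : dag ev ≫ ev = (d : ℂ) • 𝟙 (𝟙_ C)

namespace BalancedPairing

open DaggerMonoidalCategory

section Preadditive

variable {C : Type u} [Category.{v} C] [Preadditive C] [Linear ℂ C] [MonoidalCategory C]
  [DaggerCategory C] {X Y : C} {d : ℝ}

/-- The underlying exact pairing. -/
@[reducible]
def toExactPairing (P : BalancedPairing X Y d) : ExactPairing X Y where
  coevaluation' := P.coev
  evaluation' := P.ev
  coevaluation_evaluation' := P.zag
  evaluation_coevaluation' := P.zig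

lemma ev_coev (P : BalancedPairing X Y d) : P.coev ▷ X ⊗≫ X ◁ P.ev = ⊗𝟙.hom :=
  let := P.toExactPairing
  ExactPairing.evaluation_coevaluation'' X Y

/-- The adjoint pairing, which exhibits `X` as a dual of `Y`. -/
@[simps]
def symm [DaggerMonoidalCategory C] (P : BalancedPairing X Y d) : BalancedPairing Y X d where
  coev := dag P.ev
  ev := dag P.coev
  zag := by simpa using congrArg dag P.zig
  zig := by simpa using congrArg dag P.zag
  coev_loop := by rw [dag_dag, P.ev_loop]
  ev_loop := by rw [dag_dag, P.coev_loop]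

end Preadditive

section PartialTrace

variable {C : Type u} [Category.{v} C] [Preadditive C] [Linear ℂ C] [MonoidalCategory C]
  [DaggerCategory C] {X Y : C} {d : ℝ} (P : BalancedPairing X Y d)

/-- The coevaluation inserted to the right of an object. -/
def ins (A : C) : A ⟶ (A ⊗ X) ⊗ Y :=
  (ρ_ A).inv ≫ A ◁ P.coev ≫ (α_ A X Y).inv

lemma ins_naturality {A B : C} (f : A ⟶ B) : f ≫ P.ins B = P.ins A ≫ f ▷ X ▷ Y := by
  calc _ = 𝟙 _ ⊗≫ (f ▷ 𝟙_ C ≫ B ◁ P.coev) ⊗≫ 𝟙 _ := by rw [ins]; monoidal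
    _ = _ := by rw [← whisker_exchange, ins]; monoidal

/-- The evaluation applied to the left of an object. -/
def contract (A : C) : Y ⊗ (X ⊗ A) ⟶ A :=
  (α_ Y X A).inv ≫ P.ev ▷ A ≫ (λ_ A).hom

lemma contract_unit : P.contract (𝟙_ C) = Y ◁ (ρ_ X).hom ≫ P.ev := by
  rw [contract]
  monoidal

/-- The right partial trace. -/
def ptr [MonoidalPreadditive C] [MonoidalLinear ℂ C] {A B : C} :
    (A ⊗ X ⟶ B ⊗ X) →ₗ[ℂ] (A ⟶ B) where
  toFun f := P.ins A ≫ f ▷ Y ≫ dag (P.ins B)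
  map_add' f g := by simp
  map_smul' c f := by simp

lemma ptr_apply [MonoidalPreadditive C] [MonoidalLinear ℂ C] {A B : C} (f : A ⊗ X ⟶ B ⊗ X) :
    P.ptr f = P.ins A ≫ f ▷ Y ≫ dag (P.ins B) := rfl

/-- The left partial trace. -/
def leftPtr {A : C} (g : X ⊗ A ⟶ X ⊗ A) : A ⟶ A :=
  dag (P.contract A) ≫ Y ◁ g ≫ P.contract A

lemma leftPtr_sum [MonoidalPreadditive C] {A : C} {σ : Type*} (s : Finset σ)
    (g : σ → (X ⊗ A ⟶ X ⊗ A)) : P.leftPtr (∑ i ∈ s, g i) = ∑ i ∈ s, P.leftPtr (g i) := by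
  simp only [leftPtr, whiskerLeft_sum, Preadditive.sum_comp, Preadditive.comp_sum]

lemma comp_ptr [MonoidalPreadditive C] [MonoidalLinear ℂ C] {A A' B : C} (g : A' ⟶ A)
    (f : A ⊗ X ⟶ B ⊗ X) : g ≫ P.ptr f = P.ptr (g ▷ X ≫ f) := by
  simp only [ptr_apply, comp_whiskerRight, Category.assoc, reassoc_of% P.ins_naturality g]

variable [DaggerMonoidalCategory C]

lemma dag_ins (A : C) : dag (P.ins A) = (α_ A X Y).hom ≫ A ◁ dag P.coev ≫ (ρ_ A).hom := by
  simp [ins]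

lemma dag_symm_contract (A : C) :
    dag (P.symm.contract A) = (λ_ A).inv ≫ P.coev ▷ A ≫ (α_ X Y A).hom := by
  simp [contract]

lemma dag_ins_naturality {A B : C} (f : A ⟶ B) :
    f ▷ X ▷ Y ≫ dag (P.ins B) = dag (P.ins A) ≫ f := by
  simpa using (congrArg dag (P.ins_naturality (dag f))).symm

lemma whiskerRight_comp_dag_symm_ins {A B : C} (y : A ⊗ X ⟶ B) :
    (P.ins A ≫ y ▷ Y) ▷ X ≫ dag (P.symm.ins B) = y := by
  rw [dag_ins]
  simp only [ins, symm_coev, dag_dag]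
  calc _ = 𝟙 _ ⊗≫ A ◁ P.coev ▷ X ⊗≫ (y ▷ (Y ⊗ X) ≫ B ◁ P.ev) ⊗≫ 𝟙 _ := by monoidal
    _ = 𝟙 _ ⊗≫ A ◁ (P.coev ▷ X ⊗≫ X ◁ P.ev) ⊗≫ y := by
      rw [← whisker_exchange]; monoidal
    _ = y := by rw [P.ev_coev]; monoidal

lemma ins_comp_whiskerRight {A B : C} (g : A ⟶ B ⊗ Y) :
    P.ins A ≫ (g ▷ X ≫ dag (P.symm.ins B)) ▷ Y = g := by
  have h := congrArg dag (P.symm.whiskerRight_comp_dag_symm_ins (dag g))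
  simpa [ins] using h

variable [MonoidalPreadditive C] [MonoidalLinear ℂ C]

/-- Bending the right leg of a morphism `A ⊗ X ⟶ B` upwards. -/
def bend {A B : C} : (A ⊗ X ⟶ B) ≃ₗ[ℂ] (A ⟶ B ⊗ Y) where
  toFun y := P.ins A ≫ y ▷ Y
  invFun g := g ▷ X ≫ dag (P.symm.ins B)
  left_inv := P.whiskerRight_comp_dag_symm_ins
  right_inv := P.ins_comp_whiskerRight
  map_add' y y' := by simp
  map_smul' c y := by simp

@[simp] lemma bend_apply {A B : C} (y : A ⊗ X ⟶ B) : P.bend y = P.ins A ≫ y ▷ Y := rfl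

lemma ins_comp_dag_ins (A : C) : P.ins A ≫ dag (P.ins A) = (d : ℂ) • 𝟙 A := by
  rw [dag_ins]
  simp only [ins, Category.assoc, Iso.inv_hom_id_assoc]
  rw [← MonoidalCategory.whiskerLeft_comp_assoc, P.coev_loop]
  simp only [MonoidalLinear.whiskerLeft_smul, MonoidalCategory.whiskerLeft_id, Category.id_comp,
    Linear.smul_comp, Linear.comp_smul, Iso.inv_hom_id]

lemma dag_contract_comp_contract (A : C) :
    dag (P.contract A) ≫ P.contract A = (d : ℂ) • 𝟙 A := by
  simp only [contract, dag_comp, dag_whiskerRight, dag_associator_inv, dag_leftUnitor,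
    Category.assoc, Iso.hom_inv_id_assoc]
  rw [← comp_whiskerRight_assoc, P.ev_loop]
  simp only [MonoidalLinear.smul_whiskerRight, id_whiskerRight, Category.id_comp,
    Linear.smul_comp, Linear.comp_smul, Iso.inv_hom_id]

lemma ptr_comp {A B B' : C} (f : A ⊗ X ⟶ B ⊗ X) (g : B ⟶ B') :
    P.ptr f ≫ g = P.ptr (f ≫ g ▷ X) := by
  simp only [ptr_apply, comp_whiskerRight, Category.assoc, P.dag_ins_naturality]

lemma ptr_whiskerLeft (W : C) {A : C} (f : A ⊗ X ⟶ A ⊗ X) :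
    P.ptr ((α_ W A X).hom ≫ W ◁ f ≫ (α_ W A X).inv) = W ◁ P.ptr f := by
  simp only [ptr_apply, dag_ins]
  simp only [ins]
  monoidal

lemma ptr_id (A : C) : P.ptr (𝟙 (A ⊗ X)) = (d : ℂ) • 𝟙 A := by
  rw [ptr_apply, id_whiskerRight, Category.id_comp, ins_comp_dag_ins]

lemma bend_comp_dag_bend {A B : C} (y : A ⊗ X ⟶ B) :
    P.bend y ≫ dag (P.bend y) = P.ptr (y ≫ dag y) := by
  simp [ptr_apply]

lemma symm_ptr_bend {A B : C} (y : A ⊗ X ⟶ B) :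
    P.symm.ptr (dag (P.bend y) ≫ P.bend y) = dag y ≫ y := by
  conv_rhs => rw [← P.whiskerRight_comp_dag_symm_ins y]
  simp [ptr_apply]

end PartialTrace

variable {C : Type u} [Category.{v} C] [Abelian C] [Linear ℂ C] [MonoidalCategory C]
  [UnitaryCategory C] {X Y Z W : C} {d d' : ℝ}

section Simple

variable [MonoidalPreadditive C] [Simple X] (P : BalancedPairing X Y d)
include P

lemma simple_dual [MonoidalLinear ℂ C] : Simple Y :=
  let := P.toExactPairing
  simple_right_of_exactPairing X Y

lemma coev_ne_zero : P.coev ≠ 0 :=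
  let := P.toExactPairing
  coevaluation_ne_zero X Y

lemma dim_pos [Simple (𝟙_ C)] : 0 < d := by
  obtain ⟨p, hp, hpP⟩ := exists_pos_comp_dag_eq_smul_id P.coev_ne_zero
  have : (d : ℂ) = p :=
    smul_left_injective ℂ (id_nonzero (𝟙_ C)) (P.coev_loop.symm.trans hpP)
  rwa [Complex.ofReal_inj.1 this]

end Simple

section Traces

variable [Simple (𝟙_ C)]

/-- The trace of an endomorphism, with its strand closed on the right. -/
noncomputable def rightTrace (P : BalancedPairing X Y d) (g : X ⟶ X) : ℂ :=
  schurScalar (𝟙_ C) (P.coev ≫ g ▷ Y ≫ dag P.coev)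

/-- The trace of an endomorphism, with its strand closed on the left. -/
noncomputable def leftTrace (P : BalancedPairing X Y d) (g : X ⟶ X) : ℂ :=
  schurScalar (𝟙_ C) (dag P.ev ≫ Y ◁ g ≫ P.ev)

variable [MonoidalPreadditive C] [MonoidalLinear ℂ C]

lemma rightTrace_eq [Simple X] (P : BalancedPairing X Y d) (g : X ⟶ X) :
    P.rightTrace g = schurScalar X g * d := by
  apply schurScalar_eq
  conv_lhs => rw [← schurScalar_smul_id g]
  simp only [MonoidalLinear.smul_whiskerRight, id_whiskerRight, Linear.smul_comp,
    Linear.comp_smul, Category.id_comp, P.coev_loop, smul_smul]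

lemma leftTrace_eq [Simple X] (P : BalancedPairing X Y d) (g : X ⟶ X) :
    P.leftTrace g = schurScalar X g * d := by
  apply schurScalar_eq
  conv_lhs => rw [← schurScalar_smul_id g]
  simp only [MonoidalLinear.whiskerLeft_smul, MonoidalCategory.whiskerLeft_id, Linear.smul_comp,
    Linear.comp_smul, Category.id_comp, P.ev_loop, smul_smul]

end Traces

end BalancedPairing

lemma schurScalar_comp_le {D : Type u} [Category.{v} D] [Abelian D] [Linear ℂ D]
    [UnitaryCategory D] {k W : D} [Simple k] (p : k ⟶ W) (q : W ⟶ k) :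
    ‖schurScalar k (p ≫ q)‖ ^ 2 ≤
      (schurScalar k (p ≫ dag p)).re * (schurScalar k (dag q ≫ q)).re := by
  let c := homInnerCore W k
  have norm_dag : ‖schurScalar k (dag q ≫ dag p)‖ = ‖schurScalar k (p ≫ q)‖ := by
    rw [← dag_comp, schurScalar_dag, RCLike.norm_conj]
  have cauchySchwarz := InnerProductSpace.Core.inner_mul_inner_self_le (𝕜 := ℂ) (dag p) q
  change ‖schurScalar k (dag (dag p) ≫ q)‖ * ‖schurScalar k (dag q ≫ dag p)‖ ≤
    (schurScalar k (dag (dag p) ≫ dag p)).re * (schurScalar k (dag q ≫ q)).re at cauchySchwarz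
  rwa [dag_dag, norm_dag, ← sq] at cauchySchwarz

namespace BalancedPairing

open DaggerMonoidalCategory

variable {C : Type u} [Category.{v} C] [Abelian C] [Linear ℂ C] [MonoidalCategory C]
  [MonoidalPreadditive C] [MonoidalLinear ℂ C] [UnitaryCategory C] [DaggerMonoidalCategory C]
  [Simple (𝟙_ C)] {X Y Z W : C} {d d' : ℝ}

/-- Cauchy–Schwarz for the transposes of `y` and `y†`, whose composite is the transpose of
`y† ≫ y`. -/
lemma sq_schurScalar_mul_le [Simple X] (P : BalancedPairing X Y d) (R : BalancedPairing Z W d')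
    (y : Z ⟶ X) :
    ((schurScalar X (dag y ≫ y)).re * d) ^ 2 ≤
      (R.rightTrace (y ≫ dag y)).re * (R.leftTrace (y ≫ dag y)).re := by
  have := P.simple_dual
  let : HasRightDual X := { rightDual := Y, exact := P.toExactPairing }
  let : HasRightDual Z := { rightDual := W, exact := R.toExactPairing }
  let p : Y ⟶ W := yᘁ
  let q : W ⟶ Y := (dag y)ᘁ
  have hp : P.coev ≫ X ◁ p = R.coev ≫ y ▷ W := coevaluation_comp_rightAdjointMate y
  have hq : q ▷ X ≫ P.ev = W ◁ dag y ≫ R.ev := rightAdjointMate_comp_evaluation (dag y)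
  have hpq : schurScalar Y (p ≫ q) = schurScalar X (dag y ≫ y) := by
    have smul_id_mate (c : ℂ) : (c • 𝟙 X)ᘁ = c • 𝟙 (Xᘁ) := by
      rw [← rightAdjointMate_id]; simp [rightAdjointMate]
    apply schurScalar_eq
    calc p ≫ q = (dag y ≫ y)ᘁ := comp_rightAdjointMate.symm
      _ = _ := by rw [← schurScalar_smul_id (dag y ≫ y), smul_id_mate]; simp; rfl
  have norm_p : (schurScalar Y (p ≫ dag p)).re * d = (R.rightTrace (y ≫ dag y)).re := by
    have : schurScalar Y (p ≫ dag p) * d = R.rightTrace (y ≫ dag y) := by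
      have loop := congrArg (fun t => t ≫ dag t) hp
      simp only [dag_comp, dag_whiskerLeft, dag_whiskerRight, Category.assoc] at loop
      simp [← P.symm.leftTrace_eq, leftTrace, rightTrace, loop]
    simpa using congrArg Complex.re this
  have norm_q : (schurScalar Y (dag q ≫ q)).re * d = (R.leftTrace (y ≫ dag y)).re := by
    have : schurScalar Y (dag q ≫ q) * d = R.leftTrace (y ≫ dag y) := by
      have loop := congrArg (fun t => dag t ≫ t) hq
      simp only [dag_comp, dag_whiskerLeft, dag_whiskerRight, Category.assoc, dag_dag] at loop
      simp [← P.symm.rightTrace_eq, leftTrace, rightTrace, loop]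
    simpa using congrArg Complex.re this
  calc ((schurScalar X (dag y ≫ y)).re * d) ^ 2
      ≤ ‖schurScalar Y (p ≫ q)‖ ^ 2 * d ^ 2 := by
        rw [mul_pow, hpq, ← sq_abs (Complex.re _)]
        gcongr
        exact Complex.abs_re_le_norm _
    _ ≤ (schurScalar Y (p ≫ dag p)).re * (schurScalar Y (dag q ≫ q)).re * d ^ 2 := by
        gcongr
        exact schurScalar_comp_le p q
    _ = _ := by rw [← norm_p, ← norm_q]; ring

lemma dim_unique [Simple X] (P : BalancedPairing X Y d) (R : BalancedPairing X W d') :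
    d = d' := by
  have dim_le {Y W : C} {d d' : ℝ} (P : BalancedPairing X Y d) (R : BalancedPairing X W d') :
      d ≤ d' := by
    have h := P.sq_schurScalar_mul_le R (𝟙 X)
    simp only [dag_id, Category.comp_id, R.rightTrace_eq, R.leftTrace_eq, schurScalar_id, one_mul,
      Complex.one_re, Complex.ofReal_re, ← sq] at h
    exact le_of_sq_le_sq h R.dim_pos.le
  exact le_antisymm (dim_le P R) (dim_le R P)

lemma quantumDim_eq [Simple X] (P : BalancedPairing X Y d) : quantumDim X = d := by
  refine IsLeast.csInf_eq ⟨⟨Y, P.toExactPairing, P.coev_loop, P.ev_loop⟩, ?_⟩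
  rintro d' ⟨W, _, coev_loop, ev_loop⟩
  exact (P.dim_unique ⟨η_ X W, ε_ X W, ExactPairing.coevaluation_evaluation X W,
    ExactPairing.evaluation_coevaluation X W, coev_loop, ev_loop⟩).le

end BalancedPairing

lemma exists_balancedPairing {C : Type u} [Category.{v} C] [Abelian C] [Linear ℂ C]
    [MonoidalCategory C] [MonoidalPreadditive C] [MonoidalLinear ℂ C] [UnitaryCategory C]
    [Simple (𝟙_ C)] (X Y : C) [Simple X] [ExactPairing X Y] :
    ∃ d, Nonempty (BalancedPairing X Y d) := by
  obtain ⟨p, hp, coev_loop⟩ := exists_pos_comp_dag_eq_smul_id (coevaluation_ne_zero X Y)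
  obtain ⟨q, hq, ev_loop⟩ := exists_pos_dag_comp_eq_smul_id (evaluation_ne_zero X Y)
  let r : ℝ := √√(q / p)
  have hr : 0 < r := by positivity
  have hr4 : r ^ 2 * r ^ 2 * p = q := by
    rw [Real.sq_sqrt (Real.sqrt_nonneg _), Real.mul_self_sqrt (by positivity)]
    field_simp
  have hrC : (r : ℂ) ≠ 0 := by exact_mod_cast hr.ne'
  refine ⟨r ^ 2 * p, ⟨⟨(r : ℂ) • η_ X Y, (r : ℂ)⁻¹ • ε_ X Y, ?_, ?_, ?_, ?_⟩⟩⟩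
  · simp only [MonoidalLinear.whiskerLeft_smul, MonoidalLinear.smul_whiskerRight,
      Linear.comp_smul, Linear.smul_comp, smul_smul, inv_mul_cancel₀ hrC, one_smul,
      ExactPairing.coevaluation_evaluation]
  · simp only [MonoidalLinear.whiskerLeft_smul, MonoidalLinear.smul_whiskerRight,
      Linear.comp_smul, Linear.smul_comp, smul_smul, inv_mul_cancel₀ hrC, one_smul,
      ExactPairing.evaluation_coevaluation]
  · simp only [dag_smul, Linear.comp_smul, Linear.smul_comp, coev_loop, smul_smul,
      Complex.conj_ofReal]
    push_cast
    ring_nf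
  · simp only [dag_smul, Linear.comp_smul, Linear.smul_comp, ev_loop, smul_smul, map_inv₀,
      Complex.conj_ofReal, ← hr4]
    congr 1
    push_cast
    field_simp

namespace IsSimpleList

variable {C : Type u} [Category.{v} C] [Abelian C] [Linear ℂ C] [MonoidalCategory C]
  [MonoidalPreadditive C] [MonoidalLinear ℂ C] [RigidCategory C] [UnitaryCategory C]
  [UnitaryFusionCategory C] {ι : Type*} {x : ι → C}

lemma exists_dualIdx (hx : IsSimpleList x) (i : ι) :
    ∃ i', Nonempty (BalancedPairing (x i) (x i') (quantumDim (x i))) := by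
  have := hx.simple i
  obtain ⟨i', ⟨e⟩⟩ := hx.complete _ (simple_right_of_exactPairing (x i) (x i)ᘁ)
  let : ExactPairing (x i) (x i') := exactPairingCongrRight e.symm
  obtain ⟨d, ⟨P⟩⟩ := exists_balancedPairing (x i) (x i')
  exact ⟨i', by rw [P.quantumDim_eq]; exact ⟨P⟩⟩

/-- The index of the dual of the simple object `x i`. -/
noncomputable def dualIdx (hx : IsSimpleList x) (i : ι) : ι := (hx.exists_dualIdx i).choose

/-- A balanced pairing of `x i` with its dual. -/
noncomputable def dualPairing (hx : IsSimpleList x) (i : ι) :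
    BalancedPairing (x i) (x (hx.dualIdx i)) (quantumDim (x i)) :=
  (hx.exists_dualIdx i).choose_spec.some

lemma quantumDim_pos (hx : IsSimpleList x) (i : ι) : 0 < quantumDim (x i) :=
  have := hx.simple i
  (hx.dualPairing i).dim_pos

lemma quantumDim_dualIdx (hx : IsSimpleList x) (i : ι) :
    quantumDim (x (hx.dualIdx i)) = quantumDim (x i) :=
  have := hx.simple (hx.dualIdx i)
  (hx.dualPairing i).symm.quantumDim_eq

lemma dualIdx_involutive (hx : IsSimpleList x) : Function.Involutive hx.dualIdx := fun i =>
  hx.irredundant _ _ ⟨rightDualIso (hx.dualPairing (hx.dualIdx i)).toExactPairing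
    (hx.dualPairing i).symm.toExactPairing⟩

end IsSimpleList

namespace BalancedPairing

open DaggerMonoidalCategory

section Theta

variable {C : Type u} [Category.{v} C] [Abelian C] [Linear ℂ C] [MonoidalCategory C]
  [MonoidalPreadditive C] [MonoidalLinear ℂ C] [UnitaryCategory C] [DaggerMonoidalCategory C]
  {j j' b b' a a' : C} {dj db da : ℝ}
  (Pj : BalancedPairing j j' dj) (Pb : BalancedPairing b b' db)

/-- The tensor product of two pairings, with the duals in reverse order. -/
@[simps]
def tensor : BalancedPairing (j ⊗ b) (b' ⊗ j') (dj * db) where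
  coev := Pj.coev ≫ Pb.ins j ▷ j' ≫ (α_ _ _ _).hom
  ev := (α_ _ _ _).hom ≫ b' ◁ Pj.contract b ≫ Pb.ev
  zag := by
    let := Pj.toExactPairing
    let := Pb.toExactPairing
    rw [← ExactPairing.coevaluation_evaluation (j ⊗ b) (b' ⊗ j'),
      ExactPairing.tensor_coevaluation, ExactPairing.tensor_evaluation, ins, contract]
    dsimp only [ExactPairing.coevaluation, ExactPairing.evaluation]
    monoidal
  zig := by
    let := Pj.toExactPairing
    let := Pb.toExactPairing
    rw [← ExactPairing.evaluation_coevaluation (j ⊗ b) (b' ⊗ j'),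
      ExactPairing.tensor_coevaluation, ExactPairing.tensor_evaluation, ins, contract]
    dsimp only [ExactPairing.coevaluation, ExactPairing.evaluation]
    monoidal
  coev_loop := by
    simp only [dag_comp, dag_whiskerRight, dag_associator, Category.assoc,
      Iso.hom_inv_id_assoc]
    rw [← comp_whiskerRight_assoc, ins_comp_dag_ins]
    simp only [MonoidalLinear.smul_whiskerRight, id_whiskerRight, Linear.smul_comp,
      Linear.comp_smul, Category.id_comp, Pj.coev_loop, smul_smul]
    push_cast
    rw [mul_comm]
  ev_loop := by
    simp only [dag_comp, dag_whiskerLeft, dag_associator, Category.assoc, Iso.inv_hom_id_assoc]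
    rw [← MonoidalCategory.whiskerLeft_comp_assoc, dag_contract_comp_contract]
    simp only [MonoidalLinear.whiskerLeft_smul, MonoidalCategory.whiskerLeft_id,
      Linear.smul_comp, Linear.comp_smul, Category.id_comp, Pb.ev_loop, smul_smul]
    push_cast
    rfl

variable [Simple (𝟙_ C)]

lemma rightTrace_tensor (g : j ⊗ b ⟶ j ⊗ b) :
    (Pj.tensor Pb).rightTrace g = Pj.rightTrace (Pb.ptr g) := by
  simp [rightTrace, tensor_coev, ptr_apply]

lemma leftTrace_tensor (g : j ⊗ b ⟶ j ⊗ b) :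
    (Pj.tensor Pb).leftTrace g = Pb.leftTrace (Pj.leftPtr g) := by
  simp [leftTrace, tensor_ev, leftPtr]

lemma leftTrace_ptr (g : j ⊗ b ⟶ j ⊗ b) :
    Pj.leftTrace (Pb.ptr g) = Pb.rightTrace (Pj.leftPtr g) := by
  rw [leftTrace, rightTrace, ptr_apply, dag_ins, ins, leftPtr, contract]
  simp only [dag_comp, dag_whiskerRight, dag_associator_inv, dag_leftUnitor]
  congr 1
  calc _ = 𝟙 _ ⊗≫ (dag Pj.ev ▷ 𝟙_ C ≫ (j' ⊗ j) ◁ Pb.coev) ⊗≫ j' ◁ g ▷ b' ⊗≫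
        ((j' ⊗ j) ◁ dag Pb.coev ≫ Pj.ev ▷ 𝟙_ C) ⊗≫ 𝟙 _ := by monoidal
    _ = _ := by
      rw [whisker_exchange Pj.ev (dag Pb.coev), ← whisker_exchange (dag Pj.ev) Pb.coev]; monoidal

lemma leftTrace_tensor_eq_rightTrace_tensor [Simple j] [Simple b] (g : j ⊗ b ⟶ j ⊗ b) :
    (Pj.tensor Pb).leftTrace g = (Pj.tensor Pb).rightTrace g := by
  rw [leftTrace_tensor, leftTrace_eq, ← rightTrace_eq, ← leftTrace_ptr, leftTrace_eq,
    ← rightTrace_eq, rightTrace_tensor]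

variable [Simple j] [Simple b] [Simple a] (Pa : BalancedPairing a a' da)
include Pj Pa

lemma schurScalar_dag_comp_mul_le (y : j ⊗ b ⟶ a) :
    (schurScalar a (dag y ≫ y)).re * da ≤ (schurScalar j (Pb.ptr (y ≫ dag y))).re * dj := by
  have h := Pa.sq_schurScalar_mul_le (Pj.tensor Pb) y
  rw [leftTrace_tensor_eq_rightTrace_tensor, rightTrace_tensor, rightTrace_eq, ← sq,
    Complex.re_mul_ofReal] at h
  refine le_of_sq_le_sq h (mul_nonneg ?_ Pj.dim_pos.le)
  rw [← Pb.bend_comp_dag_bend]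
  exact (Complex.le_def.1 (schurScalar_comp_dag_nonneg _)).1

lemma schurScalar_ptr_comp_dag_mul (y : j ⊗ b ⟶ a) :
    schurScalar j (Pb.ptr (y ≫ dag y)) * dj = schurScalar a (dag y ≫ y) * da := by
  have := Pb.simple_dual
  have le := Pj.schurScalar_dag_comp_mul_le Pb Pa y
  have ge := Pa.schurScalar_dag_comp_mul_le Pb.symm Pj (dag (Pb.bend y))
  have real {z : ℂ} (hz : 0 ≤ z) : z = z.re := Complex.eq_re_of_ofReal_le hz
  rw [dag_dag, Pb.symm_ptr_bend] at ge
  rw [← Pb.bend_comp_dag_bend] at le ⊢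
  rw [real (schurScalar_dag_comp_nonneg y), real (schurScalar_comp_dag_nonneg (Pb.bend y))]
  exact_mod_cast le_antisymm ge le

end Theta

section Bending

variable {C : Type u} [Category.{v} C] [Preadditive C] [Linear ℂ C] [MonoidalCategory C]
  [MonoidalPreadditive C] [MonoidalLinear ℂ C] [DaggerCategory C] [DaggerMonoidalCategory C]
  {X Y : C} {d : ℝ} (P : BalancedPairing X Y d)

/-- Bending the left leg of a morphism `Y ⊗ A ⟶ B` upwards. -/
def leftBend {A B : C} : (Y ⊗ A ⟶ B) ≃ₗ[ℂ] (A ⟶ X ⊗ B) where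
  toFun f := dag (P.symm.contract A) ≫ X ◁ f
  invFun g := Y ◁ g ≫ P.contract B
  left_inv f := by
    let := P.toExactPairing
    rw [dag_symm_contract]
    simp only [Category.assoc]
    exact (tensorLeftHomEquiv A X Y B).left_inv f
  right_inv g := by
    let := P.toExactPairing
    rw [dag_symm_contract]
    simp only [Category.assoc]
    exact (tensorLeftHomEquiv A X Y B).right_inv g
  map_add' f f' := by simp
  map_smul' c f := by simp

@[simp] lemma leftBend_apply {A B : C} (f : Y ⊗ A ⟶ B) :
    P.leftBend f = dag (P.symm.contract A) ≫ X ◁ f := rfl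

lemma leftBend_comp_dag_leftBend {A B : C} (f : Y ⊗ A ⟶ B) :
    P.leftBend f ≫ dag (P.leftBend f) = P.symm.leftPtr (f ≫ dag f) := by
  simp [leftPtr]

/-- Rotating the left leg of a trivalent vertex. -/
def rotate {A B : C} : ((Y ⊗ A) ⊗ B ⟶ 𝟙_ C) ≃ₗ[ℂ] (A ⊗ B ⟶ X) where
  toFun y := P.leftBend ((α_ Y A B).inv ≫ y) ≫ (ρ_ X).hom
  invFun z := (α_ Y A B).hom ≫ Y ◁ z ≫ P.ev
  left_inv y := by
    dsimp only
    have h := P.leftBend.symm_apply_apply ((α_ Y A B).inv ≫ y)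
    change Y ◁ P.leftBend _ ≫ P.contract _ = _ at h
    rw [MonoidalCategory.whiskerLeft_comp, Category.assoc, ← contract_unit, h,
      Iso.hom_inv_id_assoc]
  right_inv z := by
    dsimp only
    have h := P.leftBend.apply_symm_apply (z ≫ (ρ_ X).inv)
    change P.leftBend (Y ◁ _ ≫ P.contract _) = _ at h
    rw [contract_unit, ← MonoidalCategory.whiskerLeft_comp_assoc, Category.assoc, Iso.inv_hom_id,
      Category.comp_id] at h
    rw [Iso.inv_hom_id_assoc, h, Category.assoc, Iso.inv_hom_id, Category.comp_id]
  map_add' y z := by simp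
  map_smul' c y := by simp

lemma rotate_apply {A B : C} (y : (Y ⊗ A) ⊗ B ⟶ 𝟙_ C) :
    P.rotate y = P.leftBend ((α_ Y A B).inv ≫ y) ≫ (ρ_ X).hom := rfl

lemma rotate_symm_apply {A B : C} (z : A ⊗ B ⟶ X) :
    P.rotate.symm z = (α_ Y A B).hom ≫ Y ◁ z ≫ P.ev := rfl

lemma symm_leftPtr_ptr {A b b' : C} {db : ℝ} (Pb : BalancedPairing b b' db)
    (y : (Y ⊗ A) ⊗ b ⟶ 𝟙_ C) :
    P.symm.leftPtr (Pb.ptr (y ≫ dag y)) = Pb.ptr (P.rotate y ≫ dag (P.rotate y)) := by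
  rw [rotate_apply, leftBend_apply, leftPtr, dag_symm_contract, ptr_apply, ptr_apply]
  simp only [ins, contract, dag_comp, dag_whiskerLeft, dag_whiskerRight, dag_associator,
    dag_associator_inv, dag_leftUnitor, dag_rightUnitor, dag_leftUnitor_inv,
    dag_rightUnitor_inv, dag_dag, symm_ev]
  calc _ = 𝟙 _ ⊗≫ (P.coev ▷ (A ⊗ 𝟙_ C) ≫ (X ⊗ Y) ◁ (A ◁ Pb.coev)) ⊗≫ X ◁ (y ≫ dag y) ▷ b' ⊗≫
        ((X ⊗ Y) ◁ (A ◁ dag Pb.coev) ≫ dag P.coev ▷ (A ⊗ 𝟙_ C)) ⊗≫ 𝟙 _ := by monoidal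
    _ = _ := by
      rw [whisker_exchange (dag P.coev) (A ◁ dag Pb.coev),
        ← whisker_exchange P.coev (A ◁ Pb.coev)]
      monoidal

end Bending

end BalancedPairing

section NatActions

variable {C : Type u} [Category.{v} C] [MonoidalCategory C]

/-- A family of morphisms `Z ⊗ A ⟶ A` that is natural in `A`. -/
abbrev NatAction (Z : C) := tensorLeft Z ⟶ 𝟭 C

namespace NatAction

variable {Z W : C}

/-- The component `Z ⊗ A ⟶ A` of a natural action. -/
def on (ξ : NatAction Z) (A : C) : Z ⊗ A ⟶ A := ξ.app A

lemma naturality (ξ : NatAction Z) {A B : C} (f : A ⟶ B) : Z ◁ f ≫ ξ.on B = ξ.on A ≫ f :=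
  NatTrans.naturality ξ f

lemma on_add [Preadditive C] (ξ ξ' : NatAction Z) (A : C) : (ξ + ξ').on A = ξ.on A + ξ'.on A := rfl

lemma on_smul [Preadditive C] [Linear ℂ C] (c : ℂ) (ξ : NatAction Z) (A : C) :
    (c • ξ).on A = c • ξ.on A := rfl

/-- The trivial action of the unit object. -/
def unit : NatAction (𝟙_ C) where
  app A := (λ_ A).hom

/-- The composite of two natural actions. -/
def comp (ω : NatAction Z) (ξ : NatAction W) : NatAction (Z ⊗ W) where
  app A := (α_ Z W A).hom ≫ Z ◁ ξ.on A ≫ ω.on A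
  naturality A B f := by
    change (Z ⊗ W) ◁ f ≫ (α_ Z W B).hom ≫ Z ◁ ξ.on B ≫ ω.on B =
      ((α_ Z W A).hom ≫ Z ◁ ξ.on A ≫ ω.on A) ≫ f
    simp only [Category.assoc, ← ω.naturality f, ← MonoidalCategory.whiskerLeft_comp_assoc,
      ← ξ.naturality f]
    simp

lemma comp_on (ω : NatAction Z) (ξ : NatAction W) (A : C) :
    (ω.comp ξ).on A = (α_ Z W A).hom ≫ Z ◁ ξ.on A ≫ ω.on A := rfl

variable [DaggerCategory C]

/-- The endomorphism of `B ⊗ A` in which the strand `Z` leaves `B` along the adjoint of `ξ` and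
is absorbed by `B ⊗ A` along `ξ'`. -/
def pair (ξ ξ' : NatAction Z) (B A : C) : B ⊗ A ⟶ B ⊗ A :=
  dag (ξ.on B) ▷ A ≫ (α_ Z B A).hom ≫ ξ'.on (B ⊗ A)

lemma pair_comp [DaggerMonoidalCategory C] (ω ω' : NatAction Z) (ξ ξ' : NatAction W) (B A : C) :
    (ω.comp ξ).pair (ω'.comp ξ') B A = ω.pair ω' B A ≫ ξ.pair ξ' B A := by
  calc _ = dag (ω.on B) ▷ A ≫ (α_ Z B A).hom ≫
        Z ◁ (dag (ξ.on B) ▷ A ≫ (α_ W B A).hom ≫ ξ'.on (B ⊗ A)) ≫ ω'.on (B ⊗ A) := by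
        simp only [pair, comp_on, dag_comp, DaggerMonoidalCategory.dag_whiskerLeft,
          DaggerMonoidalCategory.dag_associator]
        monoidal
    _ = _ := by rw [ω'.naturality, pair, pair, Category.assoc, Category.assoc]

end NatAction

end NatActions

namespace BalancedPairing

open DaggerMonoidalCategory

variable {C : Type u} [Category.{v} C]

section NatPtr

variable [Preadditive C] [Linear ℂ C] [MonoidalCategory C] [MonoidalPreadditive C]
  [MonoidalLinear ℂ C] [DaggerCategory C] [DaggerMonoidalCategory C]
  {X Y Z : C} {d : ℝ} (P : BalancedPairing X Y d)

/-- The natural action obtained by tracing out the right tensor factor `X` of `A ⊗ X`. -/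
def natPtr (ξ : NatAction Z) : NatAction Z where
  app A := P.ptr ((α_ Z A X).hom ≫ ξ.on (A ⊗ X))
  naturality A B f := by
    change Z ◁ f ≫ P.ptr ((α_ Z B X).hom ≫ ξ.on (B ⊗ X)) =
      P.ptr ((α_ Z A X).hom ≫ ξ.on (A ⊗ X)) ≫ f
    rw [comp_ptr, ptr_comp, Category.assoc, ← ξ.naturality (f ▷ X)]
    simp

lemma natPtr_on (ξ : NatAction Z) (A : C) :
    (P.natPtr ξ).on A = P.ptr ((α_ Z A X).hom ≫ ξ.on (A ⊗ X)) := rfl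

lemma pair_natPtr_left (ξ ξ' : NatAction Z) (B A : C) :
    (P.natPtr ξ).pair ξ' B A = P.ins B ▷ A ≫ (α_ (B ⊗ X) Y A).hom ≫
      ξ.pair ξ' (B ⊗ X) (Y ⊗ A) ≫ (α_ (B ⊗ X) Y A).inv ≫ dag (P.ins B) ▷ A := by
  have dag_natPtr_on : dag ((P.natPtr ξ).on B) =
      P.ins B ≫ (dag (ξ.on (B ⊗ X)) ≫ (α_ Z B X).inv) ▷ Y ≫ dag (P.ins (Z ⊗ B)) := by
    simp [natPtr_on, ptr_apply]
  have dag_ins_tensor : dag (P.ins (Z ⊗ B)) = (α_ Z B X).hom ▷ Y ≫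
      (α_ Z (B ⊗ X) Y).hom ≫ Z ◁ dag (P.ins B) := by
    simp only [dag_ins]
    monoidal
  rw [NatAction.pair, dag_natPtr_on, dag_ins_tensor]
  calc _ = P.ins B ▷ A ≫ dag (ξ.on (B ⊗ X)) ▷ Y ▷ A ≫ (α_ Z (B ⊗ X) Y).hom ▷ A ≫
        (α_ Z ((B ⊗ X) ⊗ Y) A).hom ≫ Z ◁ (dag (P.ins B) ▷ A) ≫ ξ'.on (B ⊗ A) := by monoidal
    _ = P.ins B ▷ A ≫ (α_ (B ⊗ X) Y A).hom ≫ dag (ξ.on (B ⊗ X)) ▷ (Y ⊗ A) ≫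
        (α_ Z (B ⊗ X) (Y ⊗ A)).hom ≫ (Z ◁ (α_ (B ⊗ X) Y A).inv ≫
        ξ'.on (((B ⊗ X) ⊗ Y) ⊗ A)) ≫ dag (P.ins B) ▷ A := by
      rw [ξ'.naturality]; monoidal
    _ = _ := by rw [ξ'.naturality, NatAction.pair]; simp only [Category.assoc]

end NatPtr

/-- The action of `X ⊗ Y` on `X` by evaluation. -/
def act [Preadditive C] [Linear ℂ C] [MonoidalCategory C] [DaggerCategory C] {X Y : C} {d : ℝ}
    (P : BalancedPairing X Y d) : (X ⊗ Y) ⊗ X ⟶ X :=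
  (α_ X Y X).hom ≫ X ◁ P.ev ≫ (ρ_ X).hom

variable [Abelian C] [Linear ℂ C] [MonoidalCategory C] [MonoidalPreadditive C]
  [MonoidalLinear ℂ C] [UnitaryCategory C]
  {X Y Z : C} {d : ℝ} (P : BalancedPairing X Y d)

lemma whiskerLeft_comp_act [Simple X] (g : X ⟶ X) : (X ⊗ Y) ◁ g ≫ P.act = P.act ≫ g := by
  rw [← schurScalar_smul_id g]
  simp

/-- The action of `X ⊗ Y` by evaluation on the `X`-isotypic part of an object. -/
noncomputable def isotypicAct [Simple X] : NatAction (X ⊗ Y) where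
  app A := ∑ i, (X ⊗ Y) ◁ onb A X i ≫ P.act ≫ dag (onb A X i)
  naturality A B f := by
    change (X ⊗ Y) ◁ f ≫ ∑ i, (X ⊗ Y) ◁ onb B X i ≫ P.act ≫ dag (onb B X i) =
      (∑ i, (X ⊗ Y) ◁ onb A X i ≫ P.act ≫ dag (onb A X i)) ≫ f
    trans ∑ i, ∑ l, (X ⊗ Y) ◁ onb A X l ≫ P.act ≫
      (dag (onb A X l) ≫ f ≫ onb B X i) ≫ dag (onb B X i)
    · rw [Preadditive.comp_sum]
      refine Finset.sum_congr rfl fun i _ => ?_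
      rw [← MonoidalCategory.whiskerLeft_comp_assoc]
      conv_lhs => rw [← sum_onb_comp (f ≫ onb B X i)]
      rw [whiskerLeft_sum, Preadditive.sum_comp]
      refine Finset.sum_congr rfl fun l _ => ?_
      rw [MonoidalCategory.whiskerLeft_comp_assoc, ← Category.assoc _ P.act,
        P.whiskerLeft_comp_act]
      simp only [Category.assoc]
    · rw [Finset.sum_comm, Preadditive.sum_comp]
      refine Finset.sum_congr rfl fun l _ => ?_
      simp only [Category.assoc]
      conv_rhs => rw [← sum_comp_onb (dag (onb A X l) ≫ f)]
      simp only [Preadditive.comp_sum, Category.assoc]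

lemma isotypicAct_on [Simple X] (A : C) :
    P.isotypicAct.on A = ∑ i, (X ⊗ Y) ◁ onb A X i ≫ P.act ≫ dag (onb A X i) := rfl

variable [DaggerMonoidalCategory C]

/-- The strand `X` of a morphism `X ⊗ Q ⟶ X` closed on the left. -/
def leftClose {Q : C} (v : X ⊗ Q ⟶ X) : Q ⟶ 𝟙_ C := P.symm.leftBend v ≫ P.ev

lemma comp_leftClose {Q : C} (v : X ⊗ Q ⟶ X) (t : 𝟙_ C ⟶ Q) :
    t ≫ P.leftClose v = dag P.ev ≫ Y ◁ ((ρ_ X).inv ≫ X ◁ t ≫ v) ≫ P.ev := by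
  rw [leftClose, leftBend_apply, dag_symm_contract, symm_coev]
  calc _ = 𝟙 _ ⊗≫ ((𝟙_ C) ◁ t ≫ dag P.ev ▷ Q) ⊗≫ Y ◁ v ≫ P.ev := by monoidal
    _ = _ := by rw [whisker_exchange]; monoidal

variable [Simple X]

lemma whiskerLeft_comp_leftClose {Q : C} (v : X ⊗ Q ⟶ X) (t : 𝟙_ C ⟶ Q) :
    X ◁ (t ≫ P.leftClose v) ≫ (ρ_ X).hom = (d : ℂ) • X ◁ t ≫ v := by
  obtain ⟨c, hc⟩ : ∃ c : ℂ, (ρ_ X).inv ≫ X ◁ t ≫ v = c • 𝟙 X := ⟨_, (schurScalar_smul_id _).symm⟩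
  have whiskerLeft_comp : X ◁ t ≫ v = c • (ρ_ X).hom := by
    rw [← Iso.hom_inv_id_assoc (ρ_ X) (X ◁ t ≫ v), hc, Linear.comp_smul, Category.comp_id]
  rw [comp_leftClose, hc, whiskerLeft_comp]
  simp only [MonoidalLinear.whiskerLeft_smul, MonoidalCategory.whiskerLeft_id, Category.id_comp,
    Linear.smul_comp, Linear.comp_smul, P.ev_loop, smul_smul, mul_comm]

variable [Simple (𝟙_ C)]

lemma whiskerLeft_leftClose {Q : C} (v : X ⊗ Q ⟶ X) :
    X ◁ P.leftClose v ≫ (ρ_ X).hom = (d : ℂ) • X ◁ isotypicProj Q (𝟙_ C) ≫ v := by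
  conv_lhs => rw [← isotypicProj_comp (P.leftClose v)]
  simp only [isotypicProj, Preadditive.sum_comp, Category.assoc, whiskerLeft_sum, Finset.smul_sum]
  refine Finset.sum_congr rfl fun i _ => ?_
  rw [MonoidalCategory.whiskerLeft_comp, Category.assoc, whiskerLeft_comp_leftClose,
    Linear.comp_smul, MonoidalCategory.whiskerLeft_comp_assoc]

lemma dag_act_comp_act {Q : C} (v : X ⊗ Q ⟶ X) :
    dag P.act ▷ Q ≫ (α_ (X ⊗ Y) X Q).hom ≫ (X ⊗ Y) ◁ v ≫ P.act =
      (d : ℂ) • X ◁ isotypicProj Q (𝟙_ C) ≫ v := by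
  rw [← P.whiskerLeft_leftClose, leftClose, leftBend_apply, dag_symm_contract, act]
  simp only [dag_comp, dag_whiskerLeft, dag_associator, dag_rightUnitor, symm_coev]
  monoidal

lemma dag_act_comp_isotypicAct (Q : C) :
    dag P.act ▷ Q ≫ (α_ (X ⊗ Y) X Q).hom ≫ P.isotypicAct.on (X ⊗ Q) =
      (d : ℂ) • X ◁ isotypicProj Q (𝟙_ C) := by
  have absorb : X ◁ isotypicProj Q (𝟙_ C) ≫ isotypicProj (X ⊗ Q) X =
      X ◁ isotypicProj Q (𝟙_ C) := by
    simp only [isotypicProj_eq_sum Q, whiskerLeft_sum, Preadditive.sum_comp]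
    refine Finset.sum_congr rfl fun l _ => ?_
    rw [MonoidalCategory.whiskerLeft_comp, Category.assoc,
      ← Iso.hom_inv_id_assoc (ρ_ X) (X ◁ dag (onb Q (𝟙_ C) l)), Category.assoc,
      comp_isotypicProj]
  rw [← absorb, isotypicProj_eq_sum (X ⊗ Q), isotypicAct_on]
  simp only [Preadditive.comp_sum, Finset.smul_sum]
  refine Finset.sum_congr rfl fun i _ => ?_
  simpa only [Category.assoc, Linear.smul_comp] using
    P.dag_act_comp_act (onb (X ⊗ Q) X i) =≫ dag (onb (X ⊗ Q) X i)

lemma dag_act_comp_natPtr {b b' : C} {db : ℝ} (Pb : BalancedPairing b b' db) (A : C) :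
    dag P.act ▷ A ≫ (α_ (X ⊗ Y) X A).hom ≫ (Pb.natPtr P.isotypicAct).on (X ⊗ A) =
      (d : ℂ) • X ◁ Pb.ptr (isotypicProj (A ⊗ b) (𝟙_ C)) := by
  rw [← Category.assoc, natPtr_on, comp_ptr, ← ptr_whiskerLeft, ← map_smul]
  congr 1
  calc _ = (α_ X A b).hom ≫ dag P.act ▷ (A ⊗ b) ≫ (α_ (X ⊗ Y) X (A ⊗ b)).hom ≫
        (X ⊗ Y) ◁ (α_ X A b).inv ≫ P.isotypicAct.on ((X ⊗ A) ⊗ b) := by monoidal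
    _ = (α_ X A b).hom ≫ (dag P.act ▷ (A ⊗ b) ≫ (α_ (X ⊗ Y) X (A ⊗ b)).hom ≫
        P.isotypicAct.on (X ⊗ A ⊗ b)) ≫ (α_ X A b).inv := by
      rw [P.isotypicAct.naturality]; simp only [Category.assoc]
    _ = _ := by rw [dag_act_comp_isotypicAct, Linear.smul_comp, Linear.comp_smul]

lemma pair_isotypicAct_natPtr {b b' : C} {db : ℝ} (Pb : BalancedPairing b b' db) (B A : C) :
    P.isotypicAct.pair (Pb.natPtr P.isotypicAct) B A =
      (d : ℂ) • isotypicProj B X ▷ A ≫ B ◁ Pb.ptr (isotypicProj (A ⊗ b) (𝟙_ C)) := by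
  simp only [NatAction.pair, isotypicAct_on, dag_sum, isotypicProj_eq_sum B, sum_whiskerRight,
    Preadditive.sum_comp, Finset.smul_sum]
  refine Finset.sum_congr rfl fun i _ => ?_
  set w := onb B X i
  calc _ = w ▷ A ≫ dag P.act ▷ A ≫ (α_ (X ⊗ Y) X A).hom ≫ (X ⊗ Y) ◁ (dag w ▷ A) ≫
        (Pb.natPtr P.isotypicAct).on (B ⊗ A) := by
        simp only [dag_comp, dag_dag, dag_whiskerLeft]; monoidal
    _ = w ▷ A ≫ (dag P.act ▷ A ≫ (α_ (X ⊗ Y) X A).hom ≫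
        (Pb.natPtr P.isotypicAct).on (X ⊗ A)) ≫ dag w ▷ A := by
        rw [NatAction.naturality]; simp only [Category.assoc]
    _ = _ := by
        rw [dag_act_comp_natPtr]
        simp only [Linear.smul_comp, Linear.comp_smul, comp_whiskerRight, Category.assoc]
        rw [whisker_exchange]

lemma schurScalar_rotate {A B : C} (y : (Y ⊗ A) ⊗ B ⟶ 𝟙_ C) :
    schurScalar X (dag (P.rotate y) ≫ P.rotate y) * d = schurScalar (𝟙_ C) (dag y ≫ y) := by
  conv_rhs => rw [← P.rotate.symm_apply_apply y, rotate_symm_apply]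
  rw [← P.leftTrace_eq, leftTrace]
  simp

lemma symm_leftPtr_ptr_isotypicProj {j j' b b' : C} {dj db : ℝ} [Simple j] [Simple b]
    (Pj : BalancedPairing j j' dj) (Pb : BalancedPairing b b' db) :
    P.symm.leftPtr (Pb.ptr (isotypicProj ((Y ⊗ j) ⊗ b) (𝟙_ C))) =
      ((Module.finrank ℂ (j ⊗ b ⟶ X) : ℂ) / dj) • 𝟙 j := by
  have hdj : (dj : ℂ) ≠ 0 := by exact_mod_cast Pj.dim_pos.ne'
  have term_eq i : P.symm.leftPtr (Pb.ptr (onb ((Y ⊗ j) ⊗ b) (𝟙_ C) i ≫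
      dag (onb ((Y ⊗ j) ⊗ b) (𝟙_ C) i))) = (1 / dj : ℂ) • 𝟙 j := by
    rw [symm_leftPtr_ptr, ← schurScalar_smul_id (Pb.ptr _)]
    congr 1
    rw [eq_div_iff hdj, schurScalar_ptr_comp_dag_mul Pj Pb P, schurScalar_rotate,
      dag_onb_comp_onb, if_pos rfl, schurScalar_id]
  rw [isotypicProj, map_sum, leftPtr_sum]
  simp only [term_eq, Finset.sum_const, Finset.card_univ, Fintype.card_fin]
  rw [P.rotate.finrank_eq, ← Nat.cast_smul_eq_nsmul ℂ, smul_smul, mul_one_div]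

end BalancedPairing

namespace IsSimpleList

variable {C : Type u} [Category.{v} C] [Abelian C] [Linear ℂ C] [MonoidalCategory C]
  [MonoidalPreadditive C] [MonoidalLinear ℂ C] [RigidCategory C] [UnitaryCategory C]
  [UnitaryFusionCategory C] {ι : Type*} {x : ι → C} (hx : IsSimpleList x) [∀ i, Simple (x i)]

/-- The natural action of `x k ⊗ x k*` obtained from the isotypic one by tracing out `x a`. -/
noncomputable def tracedAct (k a : ι) : NatAction (x k ⊗ x (hx.dualIdx k)) :=
  (hx.dualPairing a).natPtr (hx.dualPairing k).isotypicAct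

variable [Fintype ι]

lemma sum_pair_isotypicAct_tracedAct (b : ι) (B A : C) :
    ∑ k, (quantumDim (x k) : ℂ)⁻¹ •
      (hx.dualPairing k).isotypicAct.pair (hx.tracedAct k b) B A =
      B ◁ (hx.dualPairing b).ptr (isotypicProj (A ⊗ x b) (𝟙_ C)) := by
  have hd k : (quantumDim (x k) : ℂ)⁻¹ * quantumDim (x k) = 1 :=
    inv_mul_cancel₀ (by exact_mod_cast (hx.quantumDim_pos k).ne')
  simp only [tracedAct, BalancedPairing.pair_isotypicAct_natPtr, smul_smul, hd, one_smul]
  rw [← Preadditive.sum_comp, ← sum_whiskerRight]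
  simp only [isotypicProj_eq_sum B, hx.sum_onb_comp_dag_onb, id_whiskerRight, Category.id_comp]

lemma sum_pair_tracedAct_tracedAct (a b j : ι) (s : C) :
    ∑ k, (quantumDim (x k) : ℂ)⁻¹ • (hx.tracedAct k a).pair (hx.tracedAct k b) s (x j) =
      ((Module.finrank ℂ (x j ⊗ x b ⟶ x a) : ℂ) / quantumDim (x j)) • 𝟙 (s ⊗ x j) := by
  let P := hx.dualPairing a
  let Q := isotypicProj ((x (hx.dualIdx a) ⊗ x j) ⊗ x b) (𝟙_ C)
  have loop : P.symm.leftPtr ((hx.dualPairing b).ptr Q) =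
      ((Module.finrank ℂ (x j ⊗ x b ⟶ x a) : ℂ) / quantumDim (x j)) • 𝟙 (x j) :=
    P.symm_leftPtr_ptr_isotypicProj (hx.dualPairing j) (hx.dualPairing b)
  calc _ = P.ins s ▷ x j ≫ (α_ (s ⊗ x a) (x (hx.dualIdx a)) (x j)).hom ≫
        (s ⊗ x a) ◁ (hx.dualPairing b).ptr Q ≫
        (α_ (s ⊗ x a) (x (hx.dualIdx a)) (x j)).inv ≫ dag (P.ins s) ▷ x j := by
        rw [← hx.sum_pair_isotypicAct_tracedAct]
        simp only [Preadditive.sum_comp, Preadditive.comp_sum, Linear.smul_comp, Linear.comp_smul,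
          BalancedPairing.pair_natPtr_left, tracedAct, P]
    _ = s ◁ P.symm.leftPtr ((hx.dualPairing b).ptr Q) := by
        rw [BalancedPairing.leftPtr, P.dag_symm_contract, P.dag_ins]
        simp only [BalancedPairing.ins, BalancedPairing.contract, BalancedPairing.symm_ev]
        monoidal
    _ = _ := by
        rw [loop, MonoidalLinear.whiskerLeft_smul, MonoidalCategory.whiskerLeft_id]

end IsSimpleList

section HandleSlide

open BalancedPairing DaggerMonoidalCategory

lemma sesquilinear_ext_diag {V : Type*} [AddCommGroup V] [Module ℂ V]
    {S T : V →ₗ⋆[ℂ] V →ₗ[ℂ] ℂ} (h : ∀ y, S y y = T y y) : S = T := by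
  ext y z
  have hI := Complex.I_mul_I
  have h1 := h (y + z)
  have h2 := h (y + Complex.I • z)
  simp only [map_add, LinearMap.map_smulₛₗ, LinearMap.add_apply, LinearMap.smul_apply, map_smul,
    smul_eq_mul, Complex.conj_I] at h1 h2
  linear_combination (1 / 2 : ℂ) * h1 - (Complex.I / 2) * h2 - ((1 - Complex.I) / 2) * h y -
    ((1 + Complex.I ^ 3) / 2) * h z + (1 / 2) * (S y z - S z y - (T y z - T z y)) * hI

variable {C : Type u} [Category.{v} C]

namespace BalancedPairing

section Slide

variable [Preadditive C] [Linear ℂ C] [MonoidalCategory C] [MonoidalPreadditive C]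
  [MonoidalLinear ℂ C] [DaggerCategory C] [DaggerMonoidalCategory C]
  {s j j' t t' Z : C} {dj dt : ℝ}

/-- A trivalent vertex `s ⊗ j ⟶ t` seen as a morphism `t' ⊗ s ⟶ j'`. -/
def flipVertex (Pj : BalancedPairing j j' dj) (Pt : BalancedPairing t t' dt) :
    (s ⊗ j ⟶ t) ≃ₗ[ℂ] (t' ⊗ s ⟶ j') :=
  Pj.bend ≪≫ₗ Pt.leftBend.symm

lemma leftBend_flipVertex (Pj : BalancedPairing j j' dj) (Pt : BalancedPairing t t' dt)
    (h : s ⊗ j ⟶ t) : Pt.leftBend (flipVertex Pj Pt h) = Pj.bend h :=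
  Pt.leftBend.apply_symm_apply _

/-- The strand `t` of an action `Z ⊗ t ⟶ t` closed up. -/
def close (Pt : BalancedPairing t t' dt) (f : Z ⊗ t ⟶ t) : Z ⟶ 𝟙_ C := Pt.bend f ≫ dag Pt.coev

/-- The action of `Z` on a loop `t` standing to the left of `s`, with an endomorphism of the
returning strand `t'` and `s` inserted. -/
def loopAct (Pt : BalancedPairing t t' dt) (f : Z ⊗ t ⟶ t) :
    (t' ⊗ s ⟶ t' ⊗ s) →ₗ[ℂ] (Z ⊗ s ⟶ s) where
  toFun g := Z ◁ dag (Pt.symm.contract s) ≫ (α_ Z t (t' ⊗ s)).inv ≫ (Z ⊗ t) ◁ g ≫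
    f ▷ (t' ⊗ s) ≫ Pt.symm.contract s
  map_add' g g' := by simp
  map_smul' c g := by simp

lemma loopAct_apply (Pt : BalancedPairing t t' dt) (f : Z ⊗ t ⟶ t) (g : t' ⊗ s ⟶ t' ⊗ s) :
    Pt.loopAct f g = Z ◁ dag (Pt.symm.contract s) ≫ (α_ Z t (t' ⊗ s)).inv ≫ (Z ⊗ t) ◁ g ≫
      f ▷ (t' ⊗ s) ≫ Pt.symm.contract s := rfl

lemma loopAct_id (Pt : BalancedPairing t t' dt) (f : Z ⊗ t ⟶ t) :
    Pt.loopAct f (𝟙 (t' ⊗ s)) = Pt.close f ▷ s ≫ (λ_ s).hom := by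
  rw [loopAct_apply, dag_symm_contract, close, bend_apply, ins, contract, symm_ev]
  monoidal

lemma ptr_conj_eq_loopAct (Pj : BalancedPairing j j' dj) (Pt : BalancedPairing t t' dt)
    (f : Z ⊗ t ⟶ t) (h : s ⊗ j ⟶ t) :
    Pj.ptr ((α_ Z s j).hom ≫ Z ◁ h ≫ f ≫ dag h) =
      Pt.loopAct f (flipVertex Pj Pt h ≫ dag (flipVertex Pj Pt h)) := by
  set g := flipVertex Pj Pt h with hg
  calc _ = Z ◁ Pj.bend h ≫ (α_ Z t j').inv ≫ f ▷ j' ≫ dag (Pj.bend h) := by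
        simp only [ptr_apply, bend_apply, dag_comp, dag_whiskerRight, ins]
        monoidal
    _ = Z ◁ dag (Pt.symm.contract s) ≫ (α_ Z t (t' ⊗ s)).inv ≫ (Z ⊗ t) ◁ g ≫
        (f ▷ j' ≫ t ◁ dag g) ≫ Pt.symm.contract s := by
        rw [← leftBend_flipVertex Pj Pt h, ← hg, leftBend_apply]
        simp only [dag_comp, dag_whiskerLeft, dag_dag]
        monoidal
    _ = _ := by
        rw [← whisker_exchange, loopAct_apply]
        simp only [MonoidalCategory.whiskerLeft_comp, Category.assoc]

end Slide

variable [Abelian C] [Linear ℂ C] [MonoidalCategory C] [MonoidalPreadditive C]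
  [MonoidalLinear ℂ C] [UnitaryCategory C] [DaggerMonoidalCategory C] [Simple (𝟙_ C)]
  {s s' j j' t t' : C} {ds dj dt : ℝ} [Simple s] [Simple j] [Simple t] [Simple j']

lemma schurScalar_flipVertex_self (Ps : BalancedPairing s s' ds) (Pj : BalancedPairing j j' dj)
    (Pt : BalancedPairing t t' dt) (h : s ⊗ j ⟶ t) :
    schurScalar j' (dag (flipVertex Pj Pt h) ≫ flipVertex Pj Pt h) * dj =
      schurScalar t (dag h ≫ h) * dt := by
  have := Pt.simple_dual
  have := Ps.simple_dual
  rw [← schurScalar_ptr_comp_dag_mul Pt.symm Ps Pj.symm, ← leftTrace_eq Pt.symm, leftTrace_ptr,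
    rightTrace_eq, ← leftBend_comp_dag_leftBend, leftBend_flipVertex, bend_comp_dag_bend,
    schurScalar_ptr_comp_dag_mul Ps Pj Pt]

lemma schurScalar_flipVertex (Ps : BalancedPairing s s' ds) (Pj : BalancedPairing j j' dj)
    (Pt : BalancedPairing t t' dt) (h g : s ⊗ j ⟶ t) :
    schurScalar j' (dag (flipVertex Pj Pt h) ≫ flipVertex Pj Pt g) * dj =
      schurScalar t (dag h ≫ g) * dt := by
  let S : (s ⊗ j ⟶ t) →ₗ⋆[ℂ] (s ⊗ j ⟶ t) →ₗ[ℂ] ℂ := LinearMap.mk₂'ₛₗ (starRingEnd ℂ) (RingHom.id ℂ)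
    (fun h g => schurScalar j' (dag (flipVertex Pj Pt h) ≫ flipVertex Pj Pt g) * dj)
    (by simp [dag_add, add_mul]) (by simp [dag_smul, mul_assoc]) (by simp [add_mul])
    (by simp [mul_assoc])
  let T : (s ⊗ j ⟶ t) →ₗ⋆[ℂ] (s ⊗ j ⟶ t) →ₗ[ℂ] ℂ := LinearMap.mk₂'ₛₗ (starRingEnd ℂ) (RingHom.id ℂ)
    (fun h g => schurScalar t (dag h ≫ g) * dt)
    (by simp [dag_add, add_mul]) (by simp [dag_smul, mul_assoc]) (by simp [add_mul])
    (by simp [mul_assoc])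
  have hST : S = T := sesquilinear_ext_diag (schurScalar_flipVertex_self Ps Pj Pt)
  exact congrArg (fun U => U h g) hST

end BalancedPairing

namespace IsSimpleList

variable [Abelian C] [Linear ℂ C] [MonoidalCategory C]
  [MonoidalPreadditive C] [MonoidalLinear ℂ C] [RigidCategory C] [UnitaryCategory C]
  [UnitaryFusionCategory C] {ι : Type*} [Fintype ι] {x : ι → C} (hx : IsSimpleList x)
  [∀ i, Simple (x i)]

/-- The trivalent vertex between `x t* ⊗ x s` and `x j*` obtained from an element of the
orthonormal basis of `x s ⊗ x j ⟶ x t`. -/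
noncomputable def flippedOnb (s j t : ι) (i : Fin (Module.finrank ℂ (x s ⊗ x j ⟶ x t))) :
    x (hx.dualIdx t) ⊗ x s ⟶ x (hx.dualIdx j) :=
  flipVertex (hx.dualPairing j) (hx.dualPairing t) (onb (x s ⊗ x j) (x t) i)

lemma sum_flippedOnb_comp_dag (s t : ι) :
    ∑ j, (quantumDim (x j) : ℂ) • ∑ i, hx.flippedOnb s j t i ≫ dag (hx.flippedOnb s j t i) =
      (quantumDim (x t) : ℂ) • 𝟙 (x (hx.dualIdx t) ⊗ x s) := by
  have hd : (quantumDim (x t) : ℂ) ≠ 0 := by exact_mod_cast (hx.quantumDim_pos t).ne'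
  rw [← hx.sum_comp_dag_eq_id hx.dualIdx_involutive.bijective (fun j => hx.flippedOnb s j t)
    (fun j => (quantumDim (x j) : ℂ) / quantumDim (x t)) fun j f => ?_]
  · simp only [Finset.smul_sum (s := .univ (α := ι)), smul_smul, mul_div_cancel₀ _ hd]
  · obtain ⟨g, rfl⟩ := (flipVertex (s := x s) (hx.dualPairing j) (hx.dualPairing t)).surjective f
    conv_rhs => rw [← sum_onb_comp g, map_sum]
    rw [Finset.smul_sum]
    refine Finset.sum_congr rfl fun i _ => ?_
    simp only [flippedOnb]
    set h := onb (x s ⊗ x j) (x t) i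
    have e := schurScalar_flipVertex (hx.dualPairing s) (hx.dualPairing j) (hx.dualPairing t) h g
    rw [← schurScalar_smul_id (dag h ≫ g),
      ← schurScalar_smul_id (dag (flipVertex _ _ h) ≫ flipVertex _ _ g)]
    simp only [Linear.comp_smul, Category.comp_id, map_smul, smul_smul]
    congr 1
    rw [div_mul_eq_mul_div, div_eq_iff hd, ← e, mul_comm]

lemma natPtr_on_eq_sum_loopAct {Z : C} (ξ : NatAction Z) (s j : ι) :
    ((hx.dualPairing j).natPtr ξ).on (x s) = ∑ t, ∑ i, (hx.dualPairing t).loopAct (ξ.on (x t))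
      (hx.flippedOnb s j t i ≫ dag (hx.flippedOnb s j t i)) := by
  have on_tensor : ξ.on (x s ⊗ x j) = ∑ t, ∑ i, Z ◁ onb (x s ⊗ x j) (x t) i ≫ ξ.on (x t) ≫
      dag (onb (x s ⊗ x j) (x t) i) := by
    conv_lhs => rw [← Category.comp_id (ξ.on _), ← hx.sum_onb_comp_dag_onb]
    simp only [Preadditive.comp_sum, reassoc_of% ξ.naturality]
  rw [natPtr_on, on_tensor]
  simp only [Preadditive.comp_sum, map_sum, flippedOnb, ptr_conj_eq_loopAct _ (hx.dualPairing _)]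

lemma sum_natPtr {Z : C} (ξ : NatAction Z) (s : ι) :
    ∑ j, (quantumDim (x j) : ℂ) • ((hx.dualPairing j).natPtr ξ).on (x s) =
      (∑ t, (quantumDim (x t) : ℂ) • (hx.dualPairing t).close (ξ.on (x t))) ▷ x s ≫
        (λ_ (x s)).hom := by
  calc _ = ∑ t, (hx.dualPairing t).loopAct (ξ.on (x t)) (∑ j, (quantumDim (x j) : ℂ) •
        ∑ i, hx.flippedOnb s j t i ≫ dag (hx.flippedOnb s j t i)) := by
        simp only [natPtr_on_eq_sum_loopAct, map_sum, map_smul, Finset.smul_sum]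
        exact Finset.sum_comm
    _ = _ := by
        simp only [sum_flippedOnb_comp_dag, map_smul, loopAct_id, sum_whiskerRight,
          Preadditive.sum_comp, MonoidalLinear.smul_whiskerRight, Linear.smul_comp]

end IsSimpleList

end HandleSlide

section KroneckerPowers

open scoped Kronecker

variable {κ : Type*}

lemma kroneckerPow_zero (A : Matrix κ κ ℂ) : kroneckerPow A 0 = Matrix.of fun _ _ => 1 := by
  ext a b
  simp [kroneckerPow]

lemma kroneckerPow_succ (A : Matrix κ κ ℂ) (n : ℕ) :
    kroneckerPow A (n + 1) =
      (A ⊗ₖ kroneckerPow A n).reindex (Fin.consEquiv fun _ => κ) (Fin.consEquiv fun _ => κ) := by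
  ext a b
  exact Fin.prod_univ_succ _

lemma kroneckerPow_smul (c : ℂ) (A : Matrix κ κ ℂ) (n : ℕ) :
    kroneckerPow (c • A) n = c ^ n • kroneckerPow A n := by
  ext a b
  simp [kroneckerPow, Finset.prod_mul_distrib]

lemma posSemidef_of_forall_dotProduct_mulVec_nonneg [Fintype κ] {A : Matrix κ κ ℂ}
    (h : ∀ v : κ → ℂ, 0 ≤ star v ⬝ᵥ A.mulVec v) : A.PosSemidef := by
  classical
  rw [← Matrix.isPositive_toEuclideanLin_iff, LinearMap.isPositive_iff_complex]
  intro v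
  have hv : 0 ≤ inner ℂ v (A.toEuclideanLin v) := by
    simpa [EuclideanSpace.inner_eq_star_dotProduct, dotProduct_comm] using h v
  have hre := RCLike.nonneg_iff.1 hv
  rw [← inner_conj_symm, RCLike.conj_eq_iff_im.2 hre.2]
  exact ⟨RCLike.conj_eq_iff_re.1 (RCLike.conj_eq_iff_im.2 hre.2), hre.1⟩

end KroneckerPowers

section PositiveKernels

open BalancedPairing DaggerMonoidalCategory
open scoped Kronecker

variable {C : Type u} [Category.{v} C]

namespace BalancedPairing

lemma ptr_pair [Preadditive C] [Linear ℂ C] [MonoidalCategory C] [MonoidalPreadditive C]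
    [MonoidalLinear ℂ C] [DaggerCategory C] [DaggerMonoidalCategory C] {X Y Z : C} {d : ℝ}
    (P : BalancedPairing X Y d) (ξ ξ' : NatAction Z) (A : C) :
    P.ptr (ξ.pair ξ' A X) = dag (ξ.on A) ≫ (P.natPtr ξ').on A := by
  rw [natPtr_on, comp_ptr, NatAction.pair]

lemma schurScalar_dag_comp_whiskerRight_mul [Abelian C] [Linear ℂ C] [MonoidalCategory C]
    [MonoidalPreadditive C] [MonoidalLinear ℂ C] [UnitaryCategory C] [DaggerMonoidalCategory C]
    [Simple (𝟙_ C)] {X Y Z : C} {d : ℝ} [Simple X] (P : BalancedPairing X Y d)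
    (f : Z ⊗ X ⟶ X) (K : Z ⟶ 𝟙_ C) :
    schurScalar X (dag f ≫ K ▷ X ≫ (λ_ X).hom) * d =
      schurScalar (𝟙_ C) (dag (P.close f) ≫ K) := by
  rw [← rightTrace_eq P, rightTrace]
  congr 1
  symm
  calc dag (P.close f) ≫ K
      = 𝟙 _ ⊗≫ P.coev ⊗≫ dag f ▷ Y ⊗≫ (Z ◁ dag P.coev ≫ K ▷ 𝟙_ C) ⊗≫ 𝟙 _ := by
        simp only [close, bend_apply, dag_comp, dag_dag, dag_whiskerRight, dag_ins]
        monoidal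
    _ = _ := by
        rw [whisker_exchange K (dag P.coev)]
        monoidal

end BalancedPairing

namespace IsSimpleList

variable [Abelian C] [Linear ℂ C] [MonoidalCategory C]
  [MonoidalPreadditive C] [MonoidalLinear ℂ C] [RigidCategory C] [UnitaryCategory C]
  [UnitaryFusionCategory C] {ι : Type*} [Fintype ι] {x : ι → C} (hx : IsSimpleList x)
  [∀ i, Simple (x i)] {Z : C}

/-- The sesquilinear form on natural actions of `Z` given by the scalar of a diagram in which
`Z` runs between two strands, one carrying `∑ s, d s • x s` and the other `x j`. -/
noncomputable def actForm (j : ι) : NatAction Z →ₗ⋆[ℂ] NatAction Z →ₗ[ℂ] ℂ :=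
  LinearMap.mk₂'ₛₗ (starRingEnd ℂ) (RingHom.id ℂ)
    (fun ξ ξ' => ∑ s, (quantumDim (x s) : ℂ) ^ 2 *
      schurScalar (x s) ((hx.dualPairing j).ptr (ξ.pair ξ' (x s) (x j))))
    (fun ξ₁ ξ₂ ξ' => by
      simp [NatAction.pair, NatAction.on_add, dag_add, mul_add, Finset.sum_add_distrib])
    (fun c ξ ξ' => by
      simp [NatAction.pair, NatAction.on_smul, dag_smul, Finset.mul_sum, mul_left_comm])
    (fun ξ ξ₁ ξ₂ => by
      simp [NatAction.pair, NatAction.on_add, mul_add, Finset.sum_add_distrib])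
    (fun c ξ ξ' => by
      simp [NatAction.pair, NatAction.on_smul, Finset.mul_sum, mul_left_comm])

lemma actForm_apply (j : ι) (ξ ξ' : NatAction Z) :
    hx.actForm j ξ ξ' = ∑ s, (quantumDim (x s) : ℂ) ^ 2 *
      schurScalar (x s) ((hx.dualPairing j).ptr (ξ.pair ξ' (x s) (x j))) := rfl

/-- The closure of a natural action by the weighted sum of all loops. -/
noncomputable def kirbyClose (ξ : NatAction Z) : Z ⟶ 𝟙_ C :=
  ∑ t, (quantumDim (x t) : ℂ) • (hx.dualPairing t).close (ξ.on (x t))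

lemma sum_mul_actForm (ξ ξ' : NatAction Z) :
    ∑ j, (quantumDim (x j) : ℂ) * hx.actForm j ξ ξ' =
      schurScalar (𝟙_ C) (dag (hx.kirbyClose ξ) ≫ hx.kirbyClose ξ') := by
  calc _ = ∑ s, (quantumDim (x s) : ℂ) ^ 2 * schurScalar (x s) (dag (ξ.on (x s)) ≫
        ∑ j, (quantumDim (x j) : ℂ) • ((hx.dualPairing j).natPtr ξ').on (x s)) := by
        simp only [actForm_apply, ptr_pair, Finset.mul_sum, Preadditive.comp_sum, map_sum,
          Linear.comp_smul, map_smul, smul_eq_mul]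
        rw [Finset.sum_comm]
        simp only [mul_left_comm]
    _ = ∑ s, (quantumDim (x s) : ℂ) * schurScalar (𝟙_ C)
        (dag ((hx.dualPairing s).close (ξ.on (x s))) ≫ hx.kirbyClose ξ') := by
        refine Finset.sum_congr rfl fun s _ => ?_
        rw [sum_natPtr, ← schurScalar_dag_comp_whiskerRight_mul, kirbyClose]
        ring
    _ = _ := by
        generalize hx.kirbyClose ξ' = K
        simp only [kirbyClose, dag_sum, dag_smul, Preadditive.sum_comp, map_sum,
          Linear.smul_comp, map_smul, Complex.conj_ofReal, smul_eq_mul]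

lemma sum_mul_actForm_self_nonneg (ξ : NatAction Z) :
    0 ≤ ∑ j, (quantumDim (x j) : ℂ) * hx.actForm j ξ ξ := by
  rw [sum_mul_actForm]
  exact schurScalar_dag_comp_nonneg _

lemma sum_mul_actForm_comp_tracedAct (j a b : ι) (ξ ξ' : NatAction Z) :
    ∑ k, (quantumDim (x k) : ℂ)⁻¹ *
        hx.actForm j (ξ.comp (hx.tracedAct k a)) (ξ'.comp (hx.tracedAct k b)) =
      (quantumDim (x j) : ℂ)⁻¹ * fusionMatrix x (x j) a b * hx.actForm j ξ ξ' := by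
  simp only [actForm_apply, Finset.mul_sum]
  rw [Finset.sum_comm]
  refine Finset.sum_congr rfl fun s _ => ?_
  calc _ = (quantumDim (x s) : ℂ) ^ 2 * schurScalar (x s) ((hx.dualPairing j).ptr
        (ξ.pair ξ' (x s) (x j) ≫ ∑ k, (quantumDim (x k) : ℂ)⁻¹ •
          (hx.tracedAct k a).pair (hx.tracedAct k b) (x s) (x j))) := by
        simp only [NatAction.pair_comp, Preadditive.comp_sum, Linear.comp_smul, map_sum, map_smul,
          Finset.mul_sum, smul_eq_mul, mul_left_comm]
    _ = _ := by
        rw [sum_pair_tracedAct_tracedAct, Linear.comp_smul, Category.comp_id, map_smul, map_smul,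
          fusionMatrix, Matrix.of_apply, smul_eq_mul]
        ring

lemma actForm_unit (j : ι) : hx.actForm j NatAction.unit NatAction.unit =
    (∑ s, (quantumDim (x s) : ℂ) ^ 2) * quantumDim (x j) := by
  have pair_unit (A B : C) : NatAction.unit.pair NatAction.unit B A = 𝟙 (B ⊗ A) := by
    simp [NatAction.pair, NatAction.unit, NatAction.on]
  simp only [actForm_apply, pair_unit, ptr_id, map_smul, schurScalar_id, smul_eq_mul, mul_one,
    Finset.sum_mul]

/-- A family of kernels indexed by the simple objects is positive if, weighted by the forms
`actForm j`, it is positive on all families of natural actions of one object. -/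
def IsPosKernel {I : Type*} [Fintype I] (K : ι → Matrix I I ℂ) : Prop :=
  ∀ (Z : C) (ξ : I → NatAction Z),
    0 ≤ ∑ j, (quantumDim (x j) : ℂ) * ∑ p, ∑ q, K j p q * hx.actForm j (ξ p) (ξ q)

variable {hx} {I : Type*} [Fintype I]

variable (hx I) in
lemma isPosKernel_one : hx.IsPosKernel fun _ => (Matrix.of fun _ _ => 1 : Matrix I I ℂ) := by
  intro Z ξ
  convert hx.sum_mul_actForm_self_nonneg (∑ p, ξ p) using 3
  simp only [map_sum, LinearMap.sum_apply, Matrix.of_apply, one_mul]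
  exact Finset.sum_comm

lemma IsPosKernel.reindex {J : Type*} [Fintype J] {K : ι → Matrix I I ℂ} (h : hx.IsPosKernel K)
    (e : I ≃ J) : hx.IsPosKernel fun j => (K j).reindex e e := by
  intro Z ξ
  simpa [← e.sum_comp] using h Z (ξ ∘ e)

lemma IsPosKernel.kronecker {K : ι → Matrix I I ℂ} (h : hx.IsPosKernel K) :
    hx.IsPosKernel fun j => ((quantumDim (x j) : ℂ)⁻¹ • fusionMatrix x (x j)) ⊗ₖ K j := by
  intro Z ξ
  let η (k : ι) (p : I) := ∑ a, (ξ (a, p)).comp (hx.tracedAct k a)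
  have form_eq (j p q) : ∑ k, (quantumDim (x k) : ℂ)⁻¹ * hx.actForm j (η k p) (η k q) =
      ∑ a, ∑ b, (quantumDim (x j) : ℂ)⁻¹ * fusionMatrix x (x j) a b *
        hx.actForm j (ξ (a, p)) (ξ (b, q)) := by
    simp only [← sum_mul_actForm_comp_tracedAct, η, map_sum, LinearMap.sum_apply, Finset.mul_sum]
    exact Finset.sum_comm_cycle.trans (Finset.sum_congr rfl fun _ _ => Finset.sum_comm)
  have hd k : 0 ≤ (quantumDim (x k) : ℂ)⁻¹ :=
    inv_nonneg.2 (by exact_mod_cast (hx.quantumDim_pos k).le)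
  have key : 0 ≤ ∑ k, (quantumDim (x k) : ℂ)⁻¹ * _ :=
    Finset.sum_nonneg fun k (_ : k ∈ Finset.univ) => mul_nonneg (hd k) (h _ (η k))
  convert key using 1
  calc _ = ∑ j, (quantumDim (x j) : ℂ) * ∑ p, ∑ q, K j p q *
        ∑ k, (quantumDim (x k) : ℂ)⁻¹ * hx.actForm j (η k p) (η k q) := by
        refine Finset.sum_congr rfl fun j _ => ?_
        congr 1
        simp only [form_eq, Fintype.sum_prod_type_right, Matrix.kroneckerMap_apply,
          Matrix.smul_apply, smul_eq_mul, Finset.mul_sum]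
        refine Finset.sum_congr rfl fun p _ => ?_
        rw [Finset.sum_comm]
        refine Finset.sum_congr rfl fun q _ => Finset.sum_congr rfl fun a _ =>
          Finset.sum_congr rfl fun b _ => by ring
    _ = _ := by
        simp only [Finset.mul_sum, mul_left_comm _ (_⁻¹)]
        exact (Finset.sum_congr rfl fun _ _ => Finset.sum_comm_cycle).trans Finset.sum_comm

variable (hx) in
lemma isPosKernel_kroneckerPow (n : ℕ) : hx.IsPosKernel fun j =>
    kroneckerPow ((quantumDim (x j) : ℂ)⁻¹ • fusionMatrix x (x j)) n := by
  induction n with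
  | zero => simpa only [kroneckerPow_zero] using hx.isPosKernel_one (Fin 0 → ι)
  | succ n ih => simpa only [kroneckerPow_succ] using
      ih.kronecker.reindex (Fin.consEquiv fun _ => ι)

lemma IsPosKernel.posSemidef_sum {K : ι → Matrix I I ℂ} (h : hx.IsPosKernel K) :
    (∑ j, (quantumDim (x j) : ℂ) ^ 2 • K j).PosSemidef := by
  refine posSemidef_of_forall_dotProduct_mulVec_nonneg fun v => ?_
  obtain ⟨e, -⟩ := hx.complete (𝟙_ C) inferInstance
  have globalDim_pos : 0 < ∑ s, (quantumDim (x s) : ℂ) ^ 2 := by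
    exact_mod_cast Finset.sum_pos (fun s _ => pow_pos (hx.quantumDim_pos s) 2)
      ⟨e, Finset.mem_univ _⟩
  rw [← inv_mul_cancel_left₀ globalDim_pos.ne' (_ ⬝ᵥ _)]
  refine mul_nonneg (inv_nonneg.2 globalDim_pos.le) ?_
  convert h (𝟙_ C) fun p => v p • NatAction.unit using 1
  simp only [map_smulₛₗ, LinearMap.smul_apply, actForm_unit, smul_eq_mul,
    dotProduct, Matrix.mulVec, Matrix.sum_apply, Matrix.smul_apply, Pi.star_apply,
    Finset.mul_sum, Finset.sum_mul]
  rw [Finset.sum_comm_cycle]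
  refine Finset.sum_congr rfl fun j _ => Finset.sum_congr rfl fun p _ =>
    Finset.sum_congr rfl fun q _ => Finset.sum_congr rfl fun s _ => ?_
  rw [RingHom.id_apply, starRingEnd_apply]
  ring

lemma posSemidef_fusion {x : ι → C} (hx : IsSimpleList x) (n : ℕ) :
    (∑ j, ((quantumDim (x j) ^ (-(n : ℤ) + 2) : ℝ) : ℂ) •
      kroneckerPow (fusionMatrix x (x j)) n).PosSemidef := by
  have := hx.simple
  convert (hx.isPosKernel_kroneckerPow n).posSemidef_sum using 2 with j
  have hj : (quantumDim (x j) : ℂ) ≠ 0 := by exact_mod_cast (hx.quantumDim_pos j).ne'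
  rw [kroneckerPow_smul, smul_smul]
  push_cast
  rw [zpow_add₀ hj, zpow_neg, zpow_natCast, inv_pow, mul_comm]
  rfl

end IsSimpleList

end PositiveKernels

/-- A semisimple linear abelian category with finite-dimensional morphism spaces; unlike a
unitary category it need not carry a dagger. -/
class SemisimpleCategory (D : Type u) [Category.{v} D] [Abelian D] [Linear ℂ D] : Prop where
  finiteDimensional_hom (X Y : D) : FiniteDimensional ℂ (X ⟶ Y)
  exists_iso_biproduct (X : D) : ∃ (k : ℕ) (S : Fin k → D) (b : Bicone S),
    (∀ i, Simple (S i)) ∧ Nonempty b.IsBilimit ∧ Nonempty (b.pt ≅ X)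

section SemisimpleCategories

attribute [instance] SemisimpleCategory.finiteDimensional_hom

instance (D : Type u) [Category.{v} D] [Abelian D] [Linear ℂ D] [UnitaryCategory D] :
    SemisimpleCategory D where
  finiteDimensional_hom := finiteDimensional_hom
  exists_iso_biproduct := semisimple

section Preadditive

variable {D : Type u} [Category.{v} D] [Preadditive D] {J : Type*} [Fintype J] {S : J → D}
  {b : Bicone S} (hb : b.IsBilimit)
include hb

lemma finrank_obj_pt_hom {E : Type u'} [Category.{v'} E] [Preadditive E] [Linear ℂ E]
    [∀ Y Y' : E, FiniteDimensional ℂ (Y ⟶ Y')] (G : D ⥤ E) [G.Additive] (Y : E) :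
    Module.finrank ℂ (G.obj b.pt ⟶ Y) = ∑ i, Module.finrank ℂ (G.obj (S i) ⟶ Y) := by
  classical
  let e : (G.obj b.pt ⟶ Y) ≃ₗ[ℂ] ((i : J) → (G.obj (S i) ⟶ Y)) :=
    { toFun f i := G.map (b.ι i) ≫ f
      map_add' f g := by ext; simp
      map_smul' c f := by ext; simp
      invFun f := ∑ i, G.map (b.π i) ≫ f i
      left_inv f := by
        simp only [← G.map_comp_assoc, ← Preadditive.sum_comp, ← G.map_sum, IsBilimit.total hb,
          G.map_id, Category.id_comp]
      right_inv f := by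
        ext j
        dsimp only
        rw [Preadditive.comp_sum, Fintype.sum_eq_single j fun i hi => by
          rw [← G.map_comp_assoc, bicone_ι_π_ne b hi.symm, G.map_zero, zero_comp],
          ← G.map_comp_assoc, bicone_ι_π_self, G.map_id, Category.id_comp] }
  rw [e.finrank_eq, Module.finrank_pi_fintype]

variable [Linear ℂ D] [∀ X Y : D, FiniteDimensional ℂ (X ⟶ Y)]

lemma finrank_pt_hom (Y : D) :
    Module.finrank ℂ (b.pt ⟶ Y) = ∑ i, Module.finrank ℂ (S i ⟶ Y) :=
  finrank_obj_pt_hom hb (𝟭 D) Y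

lemma finrank_hom_pt (X : D) :
    Module.finrank ℂ (X ⟶ b.pt) = ∑ i, Module.finrank ℂ (X ⟶ S i) := by
  classical
  let e : (X ⟶ b.pt) ≃ₗ[ℂ] ((i : J) → (X ⟶ S i)) :=
    { toFun f i := f ≫ b.π i
      map_add' f g := by ext; simp
      map_smul' c f := by ext; simp
      invFun f := ∑ i, f i ≫ b.ι i
      left_inv f := by
        simp only [Category.assoc, ← Preadditive.comp_sum, IsBilimit.total hb, Category.comp_id]
      right_inv f := by
        ext j
        dsimp only
        rw [Preadditive.sum_comp, Fintype.sum_eq_single j fun i hi => by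
          rw [Category.assoc, bicone_ι_π_ne b hi, comp_zero],
          Category.assoc, bicone_ι_π_self, Category.comp_id] }
  rw [e.finrank_eq, Module.finrank_pi_fintype]

end Preadditive

variable {D : Type u} [Category.{v} D] [Abelian D] [Linear ℂ D] [SemisimpleCategory D]

lemma finrank_hom_comm (X Y : D) : Module.finrank ℂ (X ⟶ Y) = Module.finrank ℂ (Y ⟶ X) := by
  classical
  obtain ⟨_, S, b, hS, ⟨hb⟩, ⟨e⟩⟩ := SemisimpleCategory.exists_iso_biproduct X
  obtain ⟨_, T, c, hT, ⟨hc⟩, ⟨f⟩⟩ := SemisimpleCategory.exists_iso_biproduct Y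
  have finrank_simple_comm (i j) :
      Module.finrank ℂ (S i ⟶ T j) = Module.finrank ℂ (T j ⟶ S i) := by
    have := hS i
    have := hT j
    rw [finrank_hom_simple_simple, finrank_hom_simple_simple]
    exact if_congr ⟨fun ⟨g⟩ => ⟨g.symm⟩, fun ⟨g⟩ => ⟨g.symm⟩⟩ rfl rfl
  calc Module.finrank ℂ (X ⟶ Y)
    _ = ∑ i, ∑ j, Module.finrank ℂ (S i ⟶ T j) := by
      rw [← (Linear.homCongr ℂ e f).finrank_eq, finrank_pt_hom hb]
      exact Finset.sum_congr rfl fun i _ => finrank_hom_pt hc (S i)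
    _ = ∑ j, ∑ i, Module.finrank ℂ (T j ⟶ S i) := by
      rw [Finset.sum_comm]
      simp only [finrank_simple_comm]
    _ = Module.finrank ℂ (Y ⟶ X) := by
      rw [← (Linear.homCongr ℂ f e).finrank_eq, finrank_pt_hom hc]
      exact Finset.sum_congr rfl fun j _ => (finrank_hom_pt hb (T j)).symm

lemma IsSimpleList.finrank_obj_hom {ι : Type*} [Fintype ι] {x : ι → D} (hx : IsSimpleList x)
    {E : Type u'} [Category.{v'} E] [Preadditive E] [Linear ℂ E]
    [∀ Y Y' : E, FiniteDimensional ℂ (Y ⟶ Y')] (G : D ⥤ E) [G.Additive] (X : D) (Y : E) :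
    Module.finrank ℂ (G.obj X ⟶ Y) =
      ∑ p, Module.finrank ℂ (X ⟶ x p) * Module.finrank ℂ (G.obj (x p) ⟶ Y) := by
  classical
  have := hx.simple
  obtain ⟨_, S, b, hS, ⟨hb⟩, ⟨e⟩⟩ := SemisimpleCategory.exists_iso_biproduct X
  choose σ hσ using fun i => hx.complete (S i) (hS i)
  have multiplicity (p) :
      Module.finrank ℂ (X ⟶ x p) = ∑ i, if σ i = p then 1 else 0 := by
    rw [← (Linear.homCongr ℂ e (Iso.refl (x p))).finrank_eq, finrank_pt_hom hb]
    refine Finset.sum_congr rfl fun i _ => ?_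
    obtain ⟨f⟩ := hσ i
    have iso_iff : Nonempty (x (σ i) ≅ x p) ↔ σ i = p :=
      ⟨hx.irredundant _ _, fun h => ⟨eqToIso (by rw [h])⟩⟩
    rw [(Linear.homCongr ℂ f (Iso.refl (x p))).finrank_eq,
      finrank_hom_simple_simple]
    simp [iso_iff]
  rw [← (Linear.homCongr ℂ (G.mapIso e) (Iso.refl Y)).finrank_eq, finrank_obj_pt_hom hb G]
  simp only [multiplicity, Finset.sum_mul, ite_mul, one_mul, zero_mul]
  rw [Finset.sum_comm]
  refine Finset.sum_congr rfl fun i _ => ?_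
  obtain ⟨f⟩ := hσ i
  rw [Fintype.sum_ite_eq, (Linear.homCongr ℂ (G.mapIso f) (Iso.refl Y)).finrank_eq]

end SemisimpleCategories

/-- A bilinear left action of a linear monoidal category on a linear category. -/
class BilinearAction (C : Type u) [Category.{v} C] [Preadditive C] [Linear ℂ C]
    [MonoidalCategory C] (M : Type u') [Category.{v'} M] [Preadditive M] [Linear ℂ M]
    [MonoidalLeftAction C M] : Prop where
  additive_actionLeft (X : C) : (MonoidalLeftAction.actionLeft M X).Additive
  linear_actionLeft (X : C) : (MonoidalLeftAction.actionLeft M X).Linear ℂ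
  additive_actionRight (m : M) : (MonoidalLeftAction.actionRight C m).Additive
  linear_actionRight (m : M) : (MonoidalLeftAction.actionRight C m).Linear ℂ

attribute [instance] BilinearAction.additive_actionLeft BilinearAction.linear_actionLeft
  BilinearAction.additive_actionRight

open UnitaryModuleCategory in
instance (C : Type u) [Category.{v} C] [Abelian C] [Linear ℂ C] [MonoidalCategory C]
    [DaggerCategory C] (M : Type u') [Category.{v'} M] [Abelian M] [Linear ℂ M]
    [UnitaryCategory M] [MonoidalLeftAction C M] [UnitaryModuleCategory C M] :
    BilinearAction C M where
  additive_actionLeft X := ⟨actionHomRight_add X _ _⟩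
  linear_actionLeft X := ⟨fun f c => actionHomRight_smul X c f⟩
  additive_actionRight m := ⟨add_actionHomLeft _ _ m⟩
  linear_actionRight m := ⟨fun f c => smul_actionHomLeft c f m⟩

section ModuleCategories

open MonoidalLeftAction
open scoped MonoidalLeftAction

namespace BalancedPairing

section Action

variable {C : Type u} [Category.{v} C] [Preadditive C] [Linear ℂ C] [MonoidalCategory C]
  [DaggerCategory C] {M : Type u'} [Category.{v'} M] [MonoidalLeftAction C M]
  {X Y : C} {d : ℝ} (P : BalancedPairing X Y d)

/-- The action of the cup of a balanced pairing on `m`. -/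
def actionCoev (m : M) : m ⟶ X ⊙ₗ Y ⊙ₗ m :=
  (λₗ[C] m).inv ≫ P.coev ⊵ₗ m ≫ (αₗ X Y m).hom

/-- The action of the cap of a balanced pairing on `m`. -/
def actionEv (m : M) : Y ⊙ₗ X ⊙ₗ m ⟶ m :=
  (αₗ Y X m).inv ≫ P.ev ⊵ₗ m ≫ (λₗ[C] m).hom

lemma actionEv_naturality {m m' : M} (g : m ⟶ m') :
    Y ⊴ₗ X ⊴ₗ g ≫ P.actionEv m' = P.actionEv m ≫ g := by
  simp only [actionEv, Category.assoc]
  rw [actionUnitIso_hom_naturality, ← action_exchange_assoc]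
  simp

lemma actionCoev_comp_actionEv (m : M) :
    Y ⊴ₗ P.actionCoev m ≫ P.actionEv (Y ⊙ₗ m) = 𝟙 (Y ⊙ₗ m) := by
  have unit_eq : Y ⊴ₗ (λₗ[C] m).inv = (ρ_ Y).inv ⊵ₗ m ≫ (αₗ Y (𝟙_ C) m).hom := by
    rw [← cancel_mono (Y ⊴ₗ (λₗ[C] m).hom), Category.assoc, ← rightUnitor_actionHom]
    simp only [inv_hom_actionHomLeft, actionHomRight_inv_hom]
  have assoc_eq : Y ⊴ₗ (αₗ X Y m).hom ≫ (αₗ Y X (Y ⊙ₗ m)).inv ≫ (αₗ (Y ⊗ X) Y m).inv =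
      (αₗ Y (X ⊗ Y) m).inv ≫ (α_ Y X Y).inv ⊵ₗ m := by
    rw [← cancel_mono (αₗ (Y ⊗ X) Y m).hom, ← cancel_mono (αₗ Y X (Y ⊙ₗ m)).hom]
    simp only [Category.assoc, Iso.inv_hom_id, Category.comp_id, ← associator_actionHom,
      inv_hom_actionHomLeft_assoc, Iso.inv_hom_id_assoc]
  have zag : (ρ_ Y).inv ≫ Y ◁ P.coev ≫ (α_ Y X Y).inv ≫ P.ev ▷ Y ≫ (λ_ Y).hom = 𝟙 Y := by
    simp [reassoc_of% P.zag]
  have zag_action := congrArg (· ⊵ₗ m) zag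
  simp only [comp_actionHomLeft, id_actionHomLeft, whiskerLeft_actionHomLeft,
    leftUnitor_actionHom, Category.assoc] at zag_action
  simp only [actionCoev, actionEv, actionHomRight_comp, actionHomLeft_action, Category.assoc]
  rw [unit_eq, ← zag_action, Category.assoc, reassoc_of% assoc_eq]

end Action

variable {C : Type u} [Category.{v} C] [Preadditive C] [Linear ℂ C] [MonoidalCategory C]
  [DaggerCategory C] {M : Type u'} [Category.{v'} M] [Abelian M] [Linear ℂ M]
  [SemisimpleCategory M] [MonoidalLeftAction C M] [BilinearAction C M]
  {X Y : C} {d : ℝ} (P : BalancedPairing X Y d)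
include P

lemma finrank_action_le (m m' : M) :
    Module.finrank ℂ (Y ⊙ₗ m ⟶ m') ≤ Module.finrank ℂ (X ⊙ₗ m' ⟶ m) := by
  let bend : (Y ⊙ₗ m ⟶ m') →ₗ[ℂ] (m ⟶ X ⊙ₗ m') :=
    Linear.leftComp ℂ _ (P.actionCoev m) ∘ₗ (actionLeft M X).mapLinearMap ℂ
  have unbend (g : Y ⊙ₗ m ⟶ m') : Y ⊴ₗ bend g ≫ P.actionEv m' = g := by
    change Y ⊴ₗ (P.actionCoev m ≫ X ⊴ₗ g) ≫ P.actionEv m' = g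
    rw [actionHomRight_comp, Category.assoc, actionEv_naturality,
      reassoc_of% P.actionCoev_comp_actionEv m]
  rw [finrank_hom_comm (X ⊙ₗ m')]
  exact LinearMap.finrank_le_finrank_of_injective
    (Function.LeftInverse.injective (g := fun f => Y ⊴ₗ f ≫ P.actionEv m') unbend)

lemma finrank_action [DaggerMonoidalCategory C] (m m' : M) :
    Module.finrank ℂ (Y ⊙ₗ m ⟶ m') = Module.finrank ℂ (X ⊙ₗ m' ⟶ m) :=
  le_antisymm (P.finrank_action_le m m') (P.symm.finrank_action_le m' m)

end BalancedPairing

lemma moduleFusionMatrix_unit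
    {C : Type u} [Category.{v} C] [MonoidalCategory C] {M : Type u'} [Category.{v'} M]
    [Abelian M] [Linear ℂ M] [∀ m m' : M, FiniteDimensional ℂ (m ⟶ m')] [MonoidalLeftAction C M]
    {κ : Type*} {m : κ → M} [DecidableEq κ] (hm : IsSimpleList m) {X : C} (e : X ≅ 𝟙_ C) :
    moduleFusionMatrix m X = 1 := by
  have := hm.simple
  ext l k
  have finrank_eq : Module.finrank ℂ (X ⊙ₗ m k ⟶ m l) = Module.finrank ℂ (m k ⟶ m l) :=
    (Linear.homCongr ℂ ((actionRight C (m k)).mapIso e ≪≫ λₗ[C] (m k))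
      (Iso.refl (m l))).finrank_eq
  have iso_iff : Nonempty (m k ≅ m l) ↔ l = k :=
    ⟨fun h => (hm.irredundant _ _ h).symm, fun h => ⟨eqToIso (by rw [h])⟩⟩
  rw [moduleFusionMatrix, Matrix.of_apply, finrank_eq, finrank_hom_simple_simple, Matrix.one_apply]
  simp [iso_iff]

lemma moduleFusionMatrix_mul
    {C : Type u} [Category.{v} C] [Abelian C] [Linear ℂ C] [MonoidalCategory C]
    [SemisimpleCategory C] {M : Type u'} [Category.{v'} M] [Abelian M] [Linear ℂ M]
    [SemisimpleCategory M] [MonoidalLeftAction C M] [BilinearAction C M]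
    {ι κ : Type*} [Fintype ι] [Fintype κ] {x : ι → C} {m : κ → M}
    (hx : IsSimpleList x) (hm : IsSimpleList m) (i j : ι) :
    moduleFusionMatrix m (x i) * moduleFusionMatrix m (x j) =
      ∑ p, fusionMatrix x (x i) p j • moduleFusionMatrix m (x p) := by
  have := hx.simple
  have := hm.simple
  ext l k
  have count_left : Module.finrank ℂ (x i ⊙ₗ x j ⊙ₗ m k ⟶ m l) =
      ∑ q, Module.finrank ℂ (x j ⊙ₗ m k ⟶ m q) * Module.finrank ℂ (x i ⊙ₗ m q ⟶ m l) :=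
    hm.finrank_obj_hom (actionLeft M (x i)) (x j ⊙ₗ m k) (m l)
  have count_right : Module.finrank ℂ ((x i ⊗ x j) ⊙ₗ m k ⟶ m l) =
      ∑ p, Module.finrank ℂ (x i ⊗ x j ⟶ x p) * Module.finrank ℂ (x p ⊙ₗ m k ⟶ m l) :=
    hx.finrank_obj_hom (actionRight C (m k)) (x i ⊗ x j) (m l)
  rw [(Linear.homCongr ℂ (αₗ (x i) (x j) (m k)) (Iso.refl (m l))).finrank_eq,
    count_left] at count_right
  simp only [Matrix.mul_apply, Matrix.sum_apply, Matrix.smul_apply, moduleFusionMatrix,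
    fusionMatrix, Matrix.of_apply, smul_eq_mul, mul_comm (Module.finrank ℂ (x i ⊙ₗ _ ⟶ _) : ℂ)]
  exact_mod_cast count_right

lemma isHermitian_sum_kroneckerPow
    {C : Type u} [Category.{v} C] [Abelian C] [Linear ℂ C] [MonoidalCategory C]
    [MonoidalPreadditive C] [MonoidalLinear ℂ C] [RigidCategory C] [UnitaryCategory C]
    [UnitaryFusionCategory C] {M : Type u'} [Category.{v'} M] [Abelian M] [Linear ℂ M]
    [SemisimpleCategory M] [MonoidalLeftAction C M] [BilinearAction C M]
    {ι κ : Type*} [Fintype ι] {x : ι → C}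
    (hx : IsSimpleList x) (m : κ → M) (n : ℕ) :
    (∑ j, ((quantumDim (x j) ^ (-(n : ℤ) + 2) : ℝ) : ℂ) •
      kroneckerPow (moduleFusionMatrix m (x j)) n).IsHermitian := by
  ext a b
  rw [Matrix.conjTranspose_apply, Matrix.sum_apply, Matrix.sum_apply, star_sum,
    ← hx.dualIdx_involutive.bijective.sum_comp]
  refine Finset.sum_congr rfl fun j _ => ?_
  simp [kroneckerPow, moduleFusionMatrix, hx.quantumDim_dualIdx,
    (hx.dualPairing j).finrank_action]

end ModuleCategories

section KroneckerProducts

open Matrix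

variable {ι κ : Type*} [Fintype ι]

lemma nonneg_of_vecMul_eq_smul {R : Matrix ι ι ℂ} (hR : R.PosSemidef) {t : ι → ℂ} (ht : t ≠ 0)
    {μ : ℂ} (h : t ᵥ* R = μ • t) : 0 ≤ μ := by
  have t_sq_pos : 0 < t ⬝ᵥ star t := dotProduct_self_star_pos_iff.2 ht
  have form_eq : star (star t) ⬝ᵥ R *ᵥ star t = μ * (t ⬝ᵥ star t) := by
    rw [star_star, dotProduct_mulVec, h, smul_dotProduct, smul_eq_mul]
  rw [← mul_inv_cancel_right₀ t_sq_pos.ne' μ, ← form_eq]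
  exact mul_nonneg (hR.dotProduct_mulVec_nonneg _) (inv_nonneg.2 t_sq_pos.le)

-- An eigenvector `v` of `Y` yields the left eigenvector `J ↦ ⟨v, B J v⟩` of `R`.
lemma posSemidef_of_mul_eq_sum_smul [Fintype κ] [DecidableEq κ]
    {Y : Matrix κ κ ℂ} (hY : Y.IsHermitian) {R : Matrix ι ι ℂ} (hR : R.PosSemidef)
    {B : ι → Matrix κ κ ℂ}
    (hB : ∀ j, Y * B j = ∑ p, R p j • B p) {e : ι} (he : B e = 1) : Y.PosSemidef := by
  rw [hY.posSemidef_iff_eigenvalues_nonneg]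
  intro q
  let μ := hY.eigenvalues q
  let v : κ → ℂ := hY.eigenvectorBasis q
  let t : ι → ℂ := fun j => star v ⬝ᵥ B j *ᵥ v
  have v_ne : v ≠ 0 := by
    simpa [v] using hY.eigenvectorBasis.orthonormal.ne_zero q
  have vecMul_v : star v ᵥ* Y = (μ : ℂ) • star v := by
    rw [← hY.eq, ← star_mulVec, hY.mulVec_eigenvectorBasis q]
    simp [μ, v]
  have t_ne : t ≠ 0 := fun h => v_ne (dotProduct_star_self_eq_zero.1 (by
    simpa [t, he] using congrFun h e))
  have vecMul_t : t ᵥ* R = (μ : ℂ) • t := by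
    ext j
    calc ∑ p, t p * R p j = star v ⬝ᵥ (∑ p, R p j • B p) *ᵥ v := by
          simp only [t, sum_mulVec, dotProduct_sum, smul_mulVec, dotProduct_smul, smul_eq_mul,
            mul_comm (R _ _)]
      _ = μ * t j := by
          rw [← hB, ← mulVec_mulVec, dotProduct_mulVec, vecMul_v, smul_dotProduct, smul_eq_mul]
  exact_mod_cast nonneg_of_vecMul_eq_smul hR t_ne vecMul_t

/-- The Kronecker product `A 0 ⊗ ⋯ ⊗ A (n - 1)`, indexed by tuples. -/
def kroneckerProd {n : ℕ} (A : Fin n → Matrix κ κ ℂ) : Matrix (Fin n → κ) (Fin n → κ) ℂ :=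
  Matrix.of fun a b => ∏ i, A i (a i) (b i)

lemma kroneckerProd_mul [Fintype κ] {n : ℕ} (A B : Fin n → Matrix κ κ ℂ) :
    kroneckerProd A * kroneckerProd B = kroneckerProd fun i => A i * B i := by
  ext a b
  simp only [kroneckerProd, mul_apply, of_apply, ← Finset.prod_mul_distrib]
  rw [Finset.prod_univ_sum, Fintype.piFinset_univ]

lemma kroneckerProd_sum_smul {n : ℕ} (c : Fin n → ι → ℂ) (A : ι → Matrix κ κ ℂ) :
    kroneckerProd (fun i => ∑ p, c i p • A p) =
      ∑ P : Fin n → ι, (∏ i, c i (P i)) • kroneckerProd (fun i => A (P i)) := by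
  ext a b
  simp only [kroneckerProd, of_apply, Matrix.sum_apply, Matrix.smul_apply, smul_eq_mul,
    ← Finset.prod_mul_distrib]
  rw [Finset.prod_univ_sum, Fintype.piFinset_univ]

lemma kroneckerProd_one [DecidableEq κ] (n : ℕ) :
    kroneckerProd (fun _ : Fin n => (1 : Matrix κ κ ℂ)) = 1 := by
  ext a b
  simp only [kroneckerProd, of_apply, one_apply, Finset.prod_ite_zero,
    Finset.prod_const_one, funext_iff, Finset.mem_univ, true_imp_iff]

lemma posSemidef_sum_smul_kroneckerPow [Fintype κ] [DecidableEq κ] (n : ℕ) (w : ι → ℂ)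
    {N : ι → Matrix ι ι ℂ} {A : ι → Matrix κ κ ℂ}
    (hN : (∑ j, w j • kroneckerPow (N j) n).PosSemidef)
    (hA : (∑ j, w j • kroneckerPow (A j) n).IsHermitian)
    (hmul : ∀ i j, A i * A j = ∑ p, N i p j • A p) {e : ι} (he : A e = 1) :
    (∑ j, w j • kroneckerPow (A j) n).PosSemidef := by
  have kroneckerPow_mul (j : ι) (J : Fin n → ι) :
      kroneckerPow (A j) n * kroneckerProd (fun i => A (J i)) =
        ∑ P, kroneckerPow (N j) n P J • kroneckerProd fun i => A (P i) := by
    calc _ = kroneckerProd fun i => A j * A (J i) := kroneckerProd_mul _ _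
      _ = _ := by
        simp only [hmul]
        exact kroneckerProd_sum_smul _ _
  refine posSemidef_of_mul_eq_sum_smul hA hN (B := fun J => kroneckerProd fun i => A (J i))
    (fun J => ?_) (e := fun _ => e) (by simp only [he, kroneckerProd_one])
  simp only [Finset.sum_mul, smul_mul, kroneckerPow_mul, Matrix.sum_apply, Matrix.smul_apply,
    Finset.sum_smul, Finset.smul_sum, smul_smul, smul_eq_mul]
  exact Finset.sum_comm

end KroneckerProducts

theorem mainTheorem10_general
    (C : Type u) [Category.{v} C] [Abelian C] [Linear ℂ C] [MonoidalCategory C]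
    [MonoidalPreadditive C] [MonoidalLinear ℂ C] [RigidCategory C] [UnitaryCategory C]
    [UnitaryFusionCategory C]
    {ι : Type*} [Fintype ι] (x : ι → C) (hx : IsSimpleList x) (n : ℕ) :
    (∑ j, ((quantumDim (x j) ^ (-(n : ℤ) + 2) : ℝ) : ℂ) •
      kroneckerPow (fusionMatrix x (x j)) n).PosSemidef ∧
    ∀ (M : Type u') [Category.{v'} M] [Abelian M] [Linear ℂ M] [SemisimpleCategory M]
      [MonoidalLeftAction C M] [BilinearAction C M]
      {κ : Type*} [Fintype κ] (m : κ → M), IsSimpleList m →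
      (∑ j, ((quantumDim (x j) ^ (-(n : ℤ) + 2) : ℝ) : ℂ) •
        kroneckerPow (moduleFusionMatrix m (x j)) n).PosSemidef := by
  classical
  refine ⟨hx.posSemidef_fusion n, fun M _ _ _ _ _ _ κ _ m hm => ?_⟩
  obtain ⟨e, ⟨unit_iso⟩⟩ := hx.complete (𝟙_ C) inferInstance
  exact posSemidef_sum_smul_kroneckerPow n _ (hx.posSemidef_fusion n)
    (isHermitian_sum_kroneckerPow hx m n) (moduleFusionMatrix_mul hx hm)
    (moduleFusionMatrix_unit hm unit_iso.symm)

theorem mainTheorem10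
    (C : Type u) [Category.{v} C] [Abelian C] [Linear ℂ C] [MonoidalCategory C]
    [MonoidalPreadditive C] [MonoidalLinear ℂ C] [RigidCategory C] [UnitaryCategory C]
    [UnitaryFusionCategory C]
    {ι : Type*} [Fintype ι] (x : ι → C) (hx : IsSimpleList x) (n : ℕ) :
    (∑ j, ((quantumDim (x j) ^ (-(n : ℤ) + 2) : ℝ) : ℂ) •
      kroneckerPow (fusionMatrix x (x j)) n).PosSemidef ∧
    ∀ (M : Type u') [Category.{v'} M] [Abelian M] [Linear ℂ M] [UnitaryCategory M]
      [MonoidalLeftAction C M] [UnitaryModuleCategory C M]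
      {κ : Type*} [Fintype κ] (m : κ → M), IsSimpleList m →
      (∑ j, ((quantumDim (x j) ^ (-(n : ℤ) + 2) : ℝ) : ℂ) •
        kroneckerPow (moduleFusionMatrix m (x j)) n).PosSemidef :=
  (mainTheorem10_general C x hx n).imp_right fun h M _ _ _ _ _ _ _ _ m hm => h M m hm
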